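/- **Theorem (spin structure on spheres).** Let $m \ge 2$. For $n \ge 1$ let $\mathrm{Cl}_n$ be the real Clifford algebra of $\mathbb{R}^n$ with its Euclidean scalar product (with $v\cdot v = -\langle v,v\rangle$), let $\mathrm{Spin}_n \subset \mathrm{Cl}_n$ be the spin group, with its smooth structure as an embedded submanifold of the vector space $\mathrm{Cl}_n$, and let $\vartheta_n : \mathrm{Spin}_n \to \mathrm{SO}_n$ be the homomorphism for which $\vartheta_n(w)$ is the matrix of $v \mapsto w v w^{-1}$ on $\mathbb{R}^n$ (so $\vartheta_n(v_1\cdots v_r)$ is the matrix of the composition of the reflections along the hyperplanes $v_i^\perp$). Let $e_0,\dots,e_m$ be the canonical basis of $\mathbb{R}^{m+1}$, and let $\iota : \mathrm{Spin}_m \to \mathrm{Spin}_{m+1}$ be the injective homomorphism induced by the isometric inclusion $\mathbb{R}^m \to \mathbb{R}^{m+1}$, $(x_1,\dots,x_m) \mapsto \sum_{i=1}^m x_i e_i$. Let $S^m \subset \mathbb{R}^{m+1}$ be the round unit sphere, with $T_pS^m$ identified with $p^\perp \subset \mathbb{R}^{m+1}$ and oriented so that a basis $(b_1,\dots,b_m)$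 of $T_pS^m$ is positive if and only if $\det(p,b_1,\dots,b_m) > 0$. Let $\mathrm{SO}(S^m)$ be the bundle of positively oriented orthonormal frames of $S^m$, on which $\mathrm{SO}_m$ acts from the right by $(b\cdot A)_j = \sum_{i=1}^m A_{ij}\, b_i$, with its smooth structure as an embedded submanifold of $\mathbb{R}^{m+1}\times(\mathbb{R}^{m+1})^m$. Let $\Psi : \mathrm{SO}_{m+1} \to \mathrm{SO}(S^m)$ be the bijection that sends a matrix $A$ with columns $A_0,\dots,A_m$ to the frame $(A_1,\dots,A_m)$ at the point $A_0$. Set $\mathrm{Spin}(S^m) := \mathrm{Spin}_{m+1}$, on which $\mathrm{Spin}_m$ acts from the right by $w\cdot s := w\,\iota(s)$. Then: 1. the map $\pi : \mathrm{Spin}(S^m) \to S^m$, $\pi(w) = \vartheta_{m+1}(w)e_0$, is a smooth principal $\mathrm{Spin}_m$-bundle over $S^m$: $\mathrm{Spin}_m$ is a Lie group, $\pi$ and the action are smooth, $\pi$ is surjective, the action preserves the fibres of $\pi$ and is simply transitive on each of them, and $\pi$ is locally trivial by smooth $\mathrm{Spin}_m$-equivariant trivializations; 2. the map $\Theta_m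 := \Psi\circ\vartheta_{m+1} : \mathrm{Spin}(S^m) \to \mathrm{SO}(S^m)$ is a spin structure on $S^m$: it is a twofold covering map and a local diffeomorphism, it maps each fibre of $\pi$ into the fibre of $\mathrm{SO}(S^m) \to S^m$ over the same point, and $\Theta_m(w\cdot s) = \Theta_m(w)\cdot\vartheta_m(s)$ for all $w \in \mathrm{Spin}(S^m)$ and $s\in\mathrm{Spin}_m$. -/

import Mathlib

open scoped Manifold ContDiff Matrix

noncomputable section

/-! ### Clifford algebra and spin group of Euclidean space -/

/-- The negative definite quadratic form `v ↦ -⟨v, v⟩` on `ℝⁿ`, so that `v * v = -⟨v, v⟩` in the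
associated Clifford algebra. -/
abbrev cliffordForm (n : ℕ) : QuadraticForm ℝ (Fin n → ℝ) :=
  QuadraticMap.weightedSumSquares ℝ (fun _ : Fin n => (-1 : ℝ))

/-- The real Clifford algebra `Cl_n`. -/
abbrev Cl (n : ℕ) : Type := CliffordAlgebra (cliffordForm n)

/-- The inclusion of vectors `ℝⁿ → Cl_n`. -/
abbrev vec (n : ℕ) : (Fin n → ℝ) →ₗ[ℝ] Cl n := CliffordAlgebra.ι (cliffordForm n)

/-- The group `Spin_n`: even products of invertible vectors, of norm one. -/
abbrev Spin (n : ℕ) := spinGroup (cliffordForm n)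

/-- The special orthogonal group `SO_n` of real matrices. -/
abbrev SO (n : ℕ) := Matrix.specialOrthogonalGroup (Fin n) ℝ

theorem cliffordForm_apply (n : ℕ) (v : Fin n → ℝ) : cliffordForm n v = -(v ⬝ᵥ v) := by
  simp [cliffordForm, QuadraticMap.weightedSumSquares_apply, dotProduct]

instance ExteriorAlgebra.finite_pi (n : ℕ) : Module.Finite ℝ (ExteriorAlgebra ℝ (Fin n → ℝ)) := by
  have htop : (⨆ i : ℕ, ⋀[ℝ]^i (Fin n → ℝ)) = ⊤ :=
    (DirectSum.Decomposition.isInternal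
      (fun i : ℕ => ⋀[ℝ]^i (Fin n → ℝ))).submodule_iSup_eq_top
  have hbot : ∀ i : ℕ, n < i → (⋀[ℝ]^i (Fin n → ℝ)) = ⊥ := by
    intro i hi
    have h := exteriorPower.finrank_eq (R := ℝ) (M := Fin n → ℝ) i
    rw [Module.finrank_fin_fun, Nat.choose_eq_zero_of_lt hi] at h
    exact Submodule.finrank_eq_zero.mp h
  have hle : (⨆ i : ℕ, ⋀[ℝ]^i (Fin n → ℝ)) ≤ ⨆ i : Fin (n + 1), ⋀[ℝ]^(i : ℕ) (Fin n → ℝ) := by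
    refine iSup_le fun i => ?_
    by_cases hi : n < i
    · rw [hbot i hi]; exact bot_le
    · exact le_iSup (fun i : Fin (n + 1) => ⋀[ℝ]^(i : ℕ) (Fin n → ℝ)) ⟨i, by omega⟩
  rw [htop, top_le_iff] at hle
  have hfin : FiniteDimensional ℝ
      ↥(⨆ i : Fin (n + 1), ⋀[ℝ]^(i : ℕ) (Fin n → ℝ)) := Submodule.finiteDimensional_iSup _
  rw [hle] at hfin
  exact Module.Finite.equiv (Submodule.topEquiv (R := ℝ))

instance Cl.finite (n : ℕ) : Module.Finite ℝ (Cl n) :=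
  Module.Finite.equiv (CliffordAlgebra.equivExterior (cliffordForm n)).symm

/-- A norm on the finite dimensional vector space `Cl_n`; all norms are equivalent, so the induced
topology and notion of smoothness do not depend on the basis chosen. -/
instance Cl.normedAddCommGroup (n : ℕ) : NormedAddCommGroup (Cl n) :=
  NormedAddCommGroup.induced (Cl n) (Fin (Module.finrank ℝ (Cl n)) → ℝ)
    (Module.finBasis ℝ (Cl n)).equivFun (Module.finBasis ℝ (Cl n)).equivFun.injective

instance Cl.normedSpace (n : ℕ) : NormedSpace ℝ (Cl n) :=
  NormedSpace.induced ℝ (Cl n) (Fin (Module.finrank ℝ (Cl n)) → ℝ)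
    (Module.finBasis ℝ (Cl n)).equivFun

/-! ### The covering homomorphism `ϑ_n : Spin_n → SO_n` -/

/-- The linear projection of `Cl_n` onto its vector part, a left inverse of `vec n`. -/
def vecPart (n : ℕ) : Cl n →ₗ[ℝ] (Fin n → ℝ) :=
  ExteriorAlgebra.ιInv ∘ₗ (CliffordAlgebra.equivExterior (cliffordForm n)).toLinearMap

theorem vecPart_vec (n : ℕ) (v : Fin n → ℝ) : vecPart n (vec n v) = v := by
  simp [vecPart, CliffordAlgebra.equivExterior, ExteriorAlgebra.ι_leftInverse v]

theorem vec_injective (n : ℕ) : Function.Injective (vec n) :=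
  Function.LeftInverse.injective (vecPart_vec n)

/-- The twisted adjoint action `v ↦ α(x) v x⁻¹` of a unit of `Cl_n`, followed by the projection to
vectors. -/
def twistedAd (n : ℕ) (x : (Cl n)ˣ) : (Fin n → ℝ) →ₗ[ℝ] (Fin n → ℝ) :=
  vecPart n ∘ₗ LinearMap.mulRight ℝ (↑x⁻¹ : Cl n) ∘ₗ
    LinearMap.mulLeft ℝ (CliffordAlgebra.involute (x : Cl n)) ∘ₗ vec n

theorem vec_twistedAd (n : ℕ) {x : (Cl n)ˣ} (hx : x ∈ lipschitzGroup (cliffordForm n))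
    (v : Fin n → ℝ) :
    vec n (twistedAd n x v) = CliffordAlgebra.involute (x : Cl n) * vec n v * ↑x⁻¹ := by
  obtain ⟨u, hu⟩ := lipschitzGroup.involute_act_ι_mem_range_ι hx v
  simp only [twistedAd, LinearMap.comp_apply, LinearMap.mulLeft_apply, LinearMap.mulRight_apply]
  rw [← hu, vecPart_vec]

theorem twistedAd_mul (n : ℕ) {x y : (Cl n)ˣ} (hx : x ∈ lipschitzGroup (cliffordForm n))
    (hy : y ∈ lipschitzGroup (cliffordForm n)) :
    twistedAd n (x * y) = twistedAd n x ∘ₗ twistedAd n y := by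
  apply LinearMap.ext
  intro v
  apply vec_injective n
  rw [vec_twistedAd n (mul_mem hx hy), LinearMap.comp_apply, vec_twistedAd n hx,
    vec_twistedAd n hy]
  simp [mul_assoc]

theorem dotProduct_twistedAd_self (n : ℕ) {x : (Cl n)ˣ}
    (hx : x ∈ lipschitzGroup (cliffordForm n)) (v : Fin n → ℝ) :
    twistedAd n x v ⬝ᵥ twistedAd n x v = v ⬝ᵥ v := by
  have hmul : vec n (twistedAd n x v) * vec n (twistedAd n x v) = vec n v * vec n v := by
    have h2 : vec n (twistedAd n x v)
        = (x : Cl n) * vec n v * CliffordAlgebra.involute (↑x⁻¹ : Cl n) := by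
      have h := congrArg (fun y => -CliffordAlgebra.involute y) (vec_twistedAd n hx v)
      simpa using h
    have h3 : CliffordAlgebra.involute (x : Cl n) * CliffordAlgebra.involute (↑x⁻¹ : Cl n) = 1 := by
      rw [← map_mul, Units.mul_inv, map_one]
    have h4 : vec n v * vec n v = algebraMap ℝ (Cl n) (cliffordForm n v) :=
      CliffordAlgebra.ι_sq_scalar _ v
    nth_rewrite 2 [h2]
    rw [vec_twistedAd n hx v]
    calc CliffordAlgebra.involute (x : Cl n) * vec n v * ↑x⁻¹
          * (x * vec n v * CliffordAlgebra.involute (↑x⁻¹ : Cl n))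
        = CliffordAlgebra.involute (x : Cl n) * (vec n v * (↑x⁻¹ * x) * vec n v)
          * CliffordAlgebra.involute (↑x⁻¹ : Cl n) := by simp only [mul_assoc]
      _ = vec n v * vec n v := by
        rw [Units.inv_mul, mul_one, h4, ← Algebra.commutes, mul_assoc, h3, mul_one]
  rw [CliffordAlgebra.ι_sq_scalar, CliffordAlgebra.ι_sq_scalar] at hmul
  have := (algebraMap ℝ (Cl n)).injective hmul
  rw [cliffordForm_apply, cliffordForm_apply] at this
  linarith

/-- A vector acts on `ℝⁿ` by the reflection along its orthogonal hyperplane. -/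
theorem twistedAd_vec (n : ℕ) {x : (Cl n)ˣ} (a : Fin n → ℝ) (ha : vec n a = x)
    (v : Fin n → ℝ) :
    a ⬝ᵥ a ≠ 0 ∧ twistedAd n x v = v - (2 * (a ⬝ᵥ v) / (a ⬝ᵥ a)) • a := by
  have hmem : x ∈ lipschitzGroup (cliffordForm n) := Subgroup.subset_closure ⟨a, ha⟩
  have hne : a ⬝ᵥ a ≠ 0 := by
    intro h
    rw [dotProduct_self_eq_zero] at h
    rw [h, map_zero] at ha
    exact x.ne_zero ha.symm
  refine ⟨hne, ?_⟩
  apply vec_injective n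
  rw [vec_twistedAd n hmem, ← ha, CliffordAlgebra.involute_ι, Units.mul_inv_eq_iff_eq_mul, ← ha,
    map_sub, map_smul, sub_mul, smul_mul_assoc, CliffordAlgebra.ι_sq_scalar, cliffordForm_apply,
    neg_mul, CliffordAlgebra.ι_mul_ι_comm a v, neg_sub, sub_right_inj, Algebra.smul_def, ← map_mul]
  congr 1
  rw [QuadraticMap.polar, cliffordForm_apply, cliffordForm_apply, cliffordForm_apply, add_dotProduct,
    dotProduct_add, dotProduct_add, dotProduct_comm v a]
  field_simp
  ring

/-- An element of the Lipschitz group is homogeneous, and acts with determinant `1` if it is even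
and `-1` if it is odd. -/
theorem parity_det_twistedAd (n : ℕ) {x : (Cl n)ˣ} (hx : x ∈ lipschitzGroup (cliffordForm n)) :
    ((x : Cl n) ∈ CliffordAlgebra.evenOdd (cliffordForm n) 0 ∧
      LinearMap.det (twistedAd n x) = 1) ∨
    ((x : Cl n) ∈ CliffordAlgebra.evenOdd (cliffordForm n) 1 ∧
      LinearMap.det (twistedAd n x) = -1) := by
  have key : ∀ y : (Cl n)ˣ, (∃ a, vec n a = y) →
      (y : Cl n) ∈ CliffordAlgebra.evenOdd (cliffordForm n) 1 ∧
        LinearMap.det (twistedAd n y) = -1 := by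
    rintro y ⟨a, ha⟩
    have hne := (twistedAd_vec n a ha 0).1
    refine ⟨ha ▸ CliffordAlgebra.ι_mem_evenOdd_one _ a, ?_⟩
    have hM : twistedAd n y = Matrix.toLin' (1 - Matrix.replicateCol Unit ((2 / (a ⬝ᵥ a)) • a) *
        Matrix.replicateRow Unit a) := by
      apply LinearMap.ext
      intro v
      rw [(twistedAd_vec n a ha v).2]
      ext i
      simp only [Matrix.toLin'_apply, Matrix.sub_mulVec, Matrix.one_mulVec, ← Matrix.mulVec_mulVec,
        Pi.sub_apply, Pi.smul_apply, smul_eq_mul]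
      simp [Matrix.mulVec, dotProduct]
      ring
    rw [hM, LinearMap.det_toLin', Matrix.det_one_sub_mul_comm, Matrix.det_unique, Matrix.sub_apply,
      Matrix.one_apply_eq]
    have : (Matrix.replicateRow Unit a * Matrix.replicateCol Unit ((2 / (a ⬝ᵥ a)) • a))
        default default = a ⬝ᵥ ((2 / (a ⬝ᵥ a)) • a) := rfl
    rw [this, dotProduct_smul, smul_eq_mul, div_mul_cancel₀ _ hne]
    norm_num
  have hinv : ∀ y : (Cl n)ˣ, (∃ a, vec n a = y) → ∃ a, vec n a = (↑y⁻¹ : Cl n) := by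
    rintro y ⟨a, ha⟩
    have hne := (twistedAd_vec n a ha 0).1
    refine ⟨(-(a ⬝ᵥ a)⁻¹) • a, ?_⟩
    rw [eq_comm, Units.inv_eq_of_mul_eq_one_right]
    rw [← ha, map_smul, mul_smul_comm, CliffordAlgebra.ι_sq_scalar, cliffordForm_apply,
      Algebra.smul_def, ← map_mul, neg_mul_neg, inv_mul_cancel₀ hne, map_one]
  induction hx using Subgroup.closure_induction'' with
  | one =>
    refine Or.inl ⟨SetLike.GradedOne.one_mem, ?_⟩
    have : twistedAd n 1 = LinearMap.id := by
      apply LinearMap.ext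
      intro v
      apply vec_injective n
      rw [vec_twistedAd n (one_mem _)]
      simp
    rw [this, LinearMap.det_id]
  | mem y hy => exact Or.inr (key y hy)
  | inv_mem y hy => exact Or.inr (key y⁻¹ (hinv y hy))
  | mul y z hy hz ihy ihz =>
    rw [twistedAd_mul n hy hz, LinearMap.det_comp, Units.val_mul]
    have hm := fun (i j : ZMod 2) => CliffordAlgebra.evenOdd_mul_le (cliffordForm n) i j
    rcases ihy with ⟨hy1, hy2⟩ | ⟨hy1, hy2⟩ <;> rcases ihz with ⟨hz1, hz2⟩ | ⟨hz1, hz2⟩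
    · exact Or.inl ⟨hm 0 0 (Submodule.mul_mem_mul hy1 hz1), by rw [hy2, hz2]; norm_num⟩
    · exact Or.inr ⟨hm 0 1 (Submodule.mul_mem_mul hy1 hz1), by rw [hy2, hz2]; norm_num⟩
    · exact Or.inr ⟨hm 1 0 (Submodule.mul_mem_mul hy1 hz1), by rw [hy2, hz2]; norm_num⟩
    · exact Or.inl ⟨hm 1 1 (Submodule.mul_mem_mul hy1 hz1), by rw [hy2, hz2]; norm_num⟩

theorem det_twistedAd_of_even (n : ℕ) {x : (Cl n)ˣ} (hx : x ∈ lipschitzGroup (cliffordForm n))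
    (he : (x : Cl n) ∈ CliffordAlgebra.evenOdd (cliffordForm n) 0) :
    LinearMap.det (twistedAd n x) = 1 := by
  rcases parity_det_twistedAd n hx with h | h
  · exact h.2
  · have := (CliffordAlgebra.evenOdd_isCompl (cliffordForm n)).disjoint
    exact absurd (Submodule.disjoint_def.mp this _ he h.1) x.ne_zero

theorem Spin.toUnits_mem_lipschitz {n : ℕ} (w : Spin n) :
    spinGroup.toUnits w ∈ lipschitzGroup (cliffordForm n) :=
  spinGroup.units_mem_lipschitzGroup w.2

theorem toMatrix'_twistedAd_mem {n : ℕ} (w : Spin n) :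
    LinearMap.toMatrix' (twistedAd n (spinGroup.toUnits w)) ∈
      Matrix.specialOrthogonalGroup (Fin n) ℝ := by
  have hw := Spin.toUnits_mem_lipschitz w
  rw [Matrix.mem_specialOrthogonalGroup_iff, Matrix.mem_orthogonalGroup_iff']
  refine ⟨?_, by
    rw [LinearMap.det_toMatrix', det_twistedAd_of_even n hw (spinGroup.mem_even w.2)]⟩
  set T := twistedAd n (spinGroup.toUnits w) with hT
  have hpol : ∀ u v, T u ⬝ᵥ T v = u ⬝ᵥ v := by
    intro u v
    have h := dotProduct_twistedAd_self n hw (u + v)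
    rw [← hT, map_add, add_dotProduct, dotProduct_add, dotProduct_add, add_dotProduct,
      dotProduct_add, dotProduct_add, dotProduct_twistedAd_self n hw u,
      dotProduct_twistedAd_self n hw v, dotProduct_comm v u, dotProduct_comm (T v) (T u)] at h
    linarith
  ext i j
  have h := hpol (Pi.single i 1) (Pi.single j 1)
  simp only [Matrix.mul_apply, Matrix.transpose_apply, LinearMap.toMatrix'_apply]
  rw [dotProduct] at h
  rw [h, single_dotProduct, one_mul, Matrix.one_apply, Pi.single_apply]

/-- The homomorphism `ϑ_n : Spin_n → SO_n`; `ϑ_n(w)` is the coordinate matrix of `v ↦ w v w⁻¹`,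
so that `ϑ_n(v₁ ⋯ v_r)` is the matrix of the composition of the reflections along `v_i^⊥`. -/
def spinCover (n : ℕ) : Spin n →* SO n where
  toFun w := ⟨LinearMap.toMatrix' (twistedAd n (spinGroup.toUnits w)), toMatrix'_twistedAd_mem w⟩
  map_one' := by
    apply Subtype.ext
    have : twistedAd n 1 = LinearMap.id := by
      apply LinearMap.ext
      intro v
      apply vec_injective n
      rw [vec_twistedAd n (one_mem _)]
      simp
    simp [this]
  map_mul' w w' := by
    apply Subtype.ext
    have := twistedAd_mul n (Spin.toUnits_mem_lipschitz w) (Spin.toUnits_mem_lipschitz w')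
    simp [this, LinearMap.toMatrix'_comp]

theorem vec_spinCover_mulVec {n : ℕ} (w : Spin n) (v : Fin n → ℝ) :
    vec n ((spinCover n w : Matrix (Fin n) (Fin n) ℝ) *ᵥ v)
      = (w : Cl n) * vec n v * ((w⁻¹ : Spin n) : Cl n) := by
  have h := vec_twistedAd n (Spin.toUnits_mem_lipschitz w) v
  have h1 : (spinCover n w : Matrix (Fin n) (Fin n) ℝ) *ᵥ v
      = twistedAd n (spinGroup.toUnits w) v := by
    rw [← Matrix.toLin'_apply]
    exact congrArg (fun f => f v) (Matrix.toLin'_toMatrix' _)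
  rw [h1, h]
  have h2 : CliffordAlgebra.involute ((spinGroup.toUnits w : (Cl n)ˣ) : Cl n) = w :=
    spinGroup.involute_eq w.2
  rw [h2]
  rfl

/-! ### The inclusion `ι : Spin_m → Spin_{m+1}` -/

/-- The isometric inclusion `ℝ^m → ℝ^{m+1}`, `(x₁, …, x_m) ↦ (0, x₁, …, x_m)`. -/
def vecIncl (m : ℕ) : cliffordForm m →qᵢ cliffordForm (m + 1) where
  toFun x := Fin.cons 0 x
  map_add' x y := by
    ext i
    refine Fin.cases ?_ (fun j => ?_) i <;> simp
  map_smul' c x := by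
    ext i
    refine Fin.cases ?_ (fun j => ?_) i <;> simp
  map_app' x := by
    simp [QuadraticMap.weightedSumSquares_apply, Fin.sum_univ_succ]

/-- The induced algebra homomorphism `ι : Cl_m → Cl_{m+1}`. -/
def clIncl (m : ℕ) : Cl m →ₐ[ℝ] Cl (m + 1) := CliffordAlgebra.map (vecIncl m)

theorem clIncl_involute (m : ℕ) (x : Cl m) :
    clIncl m (CliffordAlgebra.involute x) = CliffordAlgebra.involute (clIncl m x) := by
  induction x using CliffordAlgebra.induction with
  | algebraMap r => simp
  | ι v => simp [clIncl]
  | mul a b ha hb => simp [ha, hb]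
  | add a b ha hb => simp [ha, hb]

theorem clIncl_reverse (m : ℕ) (x : Cl m) :
    clIncl m (CliffordAlgebra.reverse x) = CliffordAlgebra.reverse (clIncl m x) := by
  induction x using CliffordAlgebra.induction with
  | algebraMap r => simp
  | ι v => simp [clIncl]
  | mul a b ha hb => simp [ha, hb]
  | add a b ha hb => simp [ha, hb]

theorem clIncl_mem_even (m : ℕ) {x : Cl m}
    (hx : x ∈ CliffordAlgebra.evenOdd (cliffordForm m) 0) :
    clIncl m x ∈ CliffordAlgebra.evenOdd (cliffordForm (m + 1)) 0 := by
  induction x, hx using CliffordAlgebra.even_induction with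
  | algebraMap r =>
    rw [AlgHom.commutes]
    exact SetLike.algebraMap_mem_graded _ r
  | add y z hy hz ihy ihz =>
    rw [map_add]
    exact Submodule.add_mem _ ihy ihz
  | ι_mul_ι_mul a b y hy ihy =>
    rw [map_mul, map_mul, clIncl, CliffordAlgebra.map_apply_ι, CliffordAlgebra.map_apply_ι]
    exact CliffordAlgebra.evenOdd_mul_le _ 0 0
      (Submodule.mul_mem_mul (CliffordAlgebra.ι_mul_ι_mem_evenOdd_zero _ _ _) ihy)

theorem clIncl_mem_spinGroup (m : ℕ) {x : Cl m} (hx : x ∈ spinGroup (cliffordForm m)) :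
    clIncl m x ∈ spinGroup (cliffordForm (m + 1)) := by
  have hstar : ∀ y : Cl m, star (clIncl m y) = clIncl m (star y) := fun y => by
    rw [CliffordAlgebra.star_def, CliffordAlgebra.star_def, clIncl_reverse, clIncl_involute]
  refine ⟨⟨?_, ?_⟩, ?_⟩
  · obtain ⟨u, hu, rfl⟩ := hx.1.1
    refine ⟨Units.map (clIncl m : Cl m →* Cl (m + 1)) u, ?_, rfl⟩
    have hu' : u ∈ lipschitzGroup (cliffordForm m) := hu
    change Units.map (clIncl m : Cl m →* Cl (m + 1)) u ∈ lipschitzGroup (cliffordForm (m + 1))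
    have hle : lipschitzGroup (cliffordForm m) ≤ (lipschitzGroup (cliffordForm (m + 1))).comap
        (Units.map (clIncl m : Cl m →* Cl (m + 1))) := by
      refine (Subgroup.closure_le _).mpr ?_
      rintro y ⟨a, ha⟩
      refine Subgroup.subset_closure ⟨vecIncl m a, ?_⟩
      change _ = clIncl m (y : Cl m)
      rw [← ha, clIncl, CliffordAlgebra.map_apply_ι]
    exact hle hu'
  · change clIncl m x ∈ unitary (Cl (m + 1))
    rw [Unitary.mem_iff, hstar, ← map_mul, ← map_mul, hx.1.2.1, hx.1.2.2, map_one]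
    exact ⟨rfl, rfl⟩
  · have he : x ∈ CliffordAlgebra.evenOdd (cliffordForm m) 0 := hx.2
    change clIncl m x ∈ CliffordAlgebra.evenOdd (cliffordForm (m + 1)) 0
    exact clIncl_mem_even m he

/-- The inclusion `ι : Spin_m → Spin_{m+1}`. -/
def spinIncl (m : ℕ) : Spin m →* Spin (m + 1) where
  toFun s := ⟨clIncl m s.1, clIncl_mem_spinGroup m s.2⟩
  map_one' := Subtype.ext (map_one _)
  map_mul' s t := Subtype.ext (map_mul (clIncl m) s.1 t.1)

/-! ### The sphere and its oriented orthonormal frame bundle -/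

/-- The unit sphere `S^m` in `ℝ^{m+1}`. -/
abbrev Sph (m : ℕ) := Metric.sphere (0 : EuclideanSpace ℝ (Fin (m + 1))) 1

/-- The matrix with columns `p, b₁, …, b_m`. -/
def frameMatrix {m : ℕ} (p : EuclideanSpace ℝ (Fin (m + 1)))
    (b : Fin m → EuclideanSpace ℝ (Fin (m + 1))) : Matrix (Fin (m + 1)) (Fin (m + 1)) ℝ :=
  Matrix.of fun i j => (Fin.cons p b : Fin (m + 1) → EuclideanSpace ℝ (Fin (m + 1))) j i

theorem frameMatrix_gram {m : ℕ} (p : EuclideanSpace ℝ (Fin (m + 1)))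
    (b : Fin m → EuclideanSpace ℝ (Fin (m + 1))) (i j : Fin (m + 1)) :
    ((frameMatrix p b)ᵀ * frameMatrix p b) i j =
      inner ℝ ((Fin.cons p b : Fin (m + 1) → EuclideanSpace ℝ (Fin (m + 1))) i)
        ((Fin.cons p b : Fin (m + 1) → EuclideanSpace ℝ (Fin (m + 1))) j) := by
  simp only [Matrix.mul_apply, Matrix.transpose_apply, frameMatrix, Matrix.of_apply,
    PiLp.inner_apply]
  exact Finset.sum_congr rfl fun k _ => by simp [mul_comm]

theorem frameMatrix_mem_iff {m : ℕ} (p : EuclideanSpace ℝ (Fin (m + 1)))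
    (b : Fin m → EuclideanSpace ℝ (Fin (m + 1))) :
    frameMatrix p b ∈ Matrix.specialOrthogonalGroup (Fin (m + 1)) ℝ ↔
      ‖p‖ = 1 ∧ (∀ i, inner ℝ p (b i) = 0) ∧ Orthonormal ℝ b ∧ 0 < (frameMatrix p b).det := by
  have hG := frameMatrix_gram p b
  rw [Matrix.mem_specialOrthogonalGroup_iff, Matrix.mem_orthogonalGroup_iff']
  constructor
  · rintro ⟨h, hd⟩
    rw [h] at hG
    refine ⟨?_, fun i => ?_, ?_, by rw [hd]; exact one_pos⟩
    · have := hG 0 0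
      rw [Matrix.one_apply_eq, Fin.cons_zero, real_inner_self_eq_norm_sq] at this
      nlinarith [norm_nonneg p]
    · have := hG 0 i.succ
      rw [Matrix.one_apply_ne (Fin.succ_ne_zero i).symm] at this
      simpa using this.symm
    · rw [orthonormal_iff_ite]
      intro i j
      have := hG i.succ j.succ
      rw [Matrix.one_apply] at this
      simpa using this.symm
  · rintro ⟨h1, h2, h3, h4⟩
    rw [orthonormal_iff_ite] at h3
    have hA : (frameMatrix p b)ᵀ * frameMatrix p b = 1 := by
      ext i j
      rw [hG]
      refine Fin.cases ?_ (fun i => ?_) i <;> refine Fin.cases ?_ (fun j => ?_) j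
      · simp [h1]
      · simp [h2, (Fin.succ_ne_zero j).symm]
      · simp [real_inner_comm, h2]
      · simp [h3, Matrix.one_apply]
    refine ⟨hA, ?_⟩
    have hd := congrArg Matrix.det hA
    rw [Matrix.det_mul, Matrix.det_transpose, Matrix.det_one] at hd
    nlinarith

/-- The inclusion `j : SO_m → SO_{m+1}`, `A ↦ diag(1, A)`, on matrices. -/
def blockIncl {m : ℕ} (A : Matrix (Fin m) (Fin m) ℝ) : Matrix (Fin (m + 1)) (Fin (m + 1)) ℝ :=
  Matrix.of (Fin.cons (Fin.cons 1 0) fun i => Fin.cons 0 (A i))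

theorem blockIncl_mem {m : ℕ} (A : SO m) :
    blockIncl (A : Matrix (Fin m) (Fin m) ℝ) ∈ Matrix.specialOrthogonalGroup (Fin (m + 1)) ℝ := by
  obtain ⟨A, hA⟩ := A
  rw [Matrix.mem_specialOrthogonalGroup_iff, Matrix.mem_orthogonalGroup_iff] at hA ⊢
  obtain ⟨h, hd⟩ := hA
  constructor
  · ext i j
    have h' := fun i j => congrFun (congrFun h i) j
    simp only [Matrix.mul_apply, Matrix.transpose_apply] at h'
    rw [Matrix.mul_apply, Fin.sum_univ_succ]
    simp only [Matrix.transpose_apply, blockIncl, Matrix.of_apply]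
    refine Fin.cases ?_ (fun i => ?_) i <;> refine Fin.cases ?_ (fun j => ?_) j
    · simp
    · simp [(Fin.succ_ne_zero j).symm]
    · simp
    · simp [h', Matrix.one_apply]
  · rw [Matrix.det_succ_column_zero, Fin.sum_univ_succ]
    have : (blockIncl A).submatrix (Fin.succAbove 0) Fin.succ = A := by
      ext i j
      simp [blockIncl]
    rw [this, hd, Finset.sum_eq_zero fun i _ => ?_]
    · simp [blockIncl]
    · simp [blockIncl]

/-- The bundle `SO(S^m)` of positively oriented orthonormal frames of the round sphere: pairs of a
point `p ∈ S^m` and an orthonormal basis `(b₁, …, b_m)` of `T_p S^m = p^⊥` such that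
`(p, b₁, …, b_m)` is a positively oriented basis of `ℝ^{m+1}`. -/
abbrev SphereFrame (m : ℕ) : Type :=
  {x : Sph m × (Fin m → EuclideanSpace ℝ (Fin (m + 1))) //
    (∀ i, inner ℝ (x.1 : EuclideanSpace ℝ (Fin (m + 1))) (x.2 i) = 0) ∧
      Orthonormal ℝ x.2 ∧ 0 < (frameMatrix (x.1 : EuclideanSpace ℝ (Fin (m + 1))) x.2).det}

namespace SphereFrame

variable {m : ℕ}

/-- The foot point of a frame. -/
def pt (x : SphereFrame m) : Sph m := x.1.1

/-- The members of a frame. -/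
def fr (x : SphereFrame m) : Fin m → EuclideanSpace ℝ (Fin (m + 1)) := x.1.2

/-- The right action of `SO_m` on frames, `(b . A)_j = ∑ i, A_{ij} b_i`. -/
def act (x : SphereFrame m) (A : SO m) : SphereFrame m :=
  ⟨(x.pt, fun j => ∑ i, (A : Matrix (Fin m) (Fin m) ℝ) i j • x.fr i), by
    have hx := (frameMatrix_mem_iff (x.pt : EuclideanSpace ℝ (Fin (m + 1))) x.fr).mpr
      ⟨norm_eq_of_mem_sphere x.pt, x.2⟩
    have hmul := mul_mem hx (blockIncl_mem A)
    have heq : frameMatrix (x.pt : EuclideanSpace ℝ (Fin (m + 1))) x.fr *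
        blockIncl (A : Matrix (Fin m) (Fin m) ℝ) =
        frameMatrix (x.pt : EuclideanSpace ℝ (Fin (m + 1)))
          (fun j => ∑ i, (A : Matrix (Fin m) (Fin m) ℝ) i j • x.fr i) := by
      ext i j
      rw [Matrix.mul_apply, Fin.sum_univ_succ]
      refine Fin.cases ?_ (fun j => ?_) j
      · simp [frameMatrix, blockIncl]
      · simp [frameMatrix, blockIncl, mul_comm]
    rw [heq] at hmul
    exact ((frameMatrix_mem_iff _ _).mp hmul).2⟩

/-- The inclusion of `SO(S^m)` into the vector space `ℝ^{m+1} × (ℝ^{m+1})^m`. -/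
def incl (x : SphereFrame m) :
    EuclideanSpace ℝ (Fin (m + 1)) × (Fin m → EuclideanSpace ℝ (Fin (m + 1))) :=
  (x.pt, x.fr)

end SphereFrame

/-- The `j`-th column of a matrix, as a vector of Euclidean space. -/
def column {n : ℕ} (A : Matrix (Fin n) (Fin n) ℝ) (j : Fin n) : EuclideanSpace ℝ (Fin n) :=
  WithLp.toLp 2 fun i => A i j

theorem frameMatrix_column {m : ℕ} (A : Matrix (Fin (m + 1)) (Fin (m + 1)) ℝ) :
    frameMatrix (column A 0) (fun j => column A j.succ) = A := by
  ext i j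
  refine Fin.cases ?_ (fun j => ?_) j <;> simp [frameMatrix, column]

theorem column_mem {m : ℕ} (A : SO (m + 1)) :
    ‖column A.1 0‖ = 1 ∧ (∀ i : Fin m, inner ℝ (column A.1 0) (column A.1 i.succ) = 0) ∧
      Orthonormal ℝ (fun i : Fin m => column A.1 i.succ) ∧
      0 < (frameMatrix (column A.1 0) fun i : Fin m => column A.1 i.succ).det :=
  (frameMatrix_mem_iff _ _).mp
    ((frameMatrix_column (A : Matrix (Fin (m + 1)) (Fin (m + 1)) ℝ)).symm ▸ A.2)

/-- The identification `Ψ : SO_{m+1} → SO(S^m)`, `A ↦ (A₁, …, A_m) ∈ SO_{A₀}(S^m)`, where `A_i` is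
the `i`-th column of `A`. -/
def frameOfSO (m : ℕ) : SO (m + 1) ≃ SphereFrame m where
  toFun A := ⟨(⟨column A.1 0, mem_sphere_zero_iff_norm.mpr (column_mem A).1⟩,
    fun j => column A.1 j.succ), (column_mem A).2⟩
  invFun x := ⟨frameMatrix (x.pt : EuclideanSpace ℝ (Fin (m + 1))) x.fr,
    (frameMatrix_mem_iff _ _).mpr ⟨norm_eq_of_mem_sphere x.pt, x.2⟩⟩
  left_inv _ := Subtype.ext (frameMatrix_column _)
  right_inv _ := rfl

theorem spinProj_mem {m : ℕ} (A : SO (m + 1)) :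
    WithLp.toLp 2 ((A : Matrix (Fin (m + 1)) (Fin (m + 1)) ℝ) *ᵥ
      (Pi.single 0 1 : Fin (m + 1) → ℝ)) ∈ Metric.sphere (0 : EuclideanSpace ℝ (Fin (m + 1))) 1 := by
  rw [Matrix.mulVec_single_one]
  exact mem_sphere_zero_iff_norm.mpr (column_mem A).1

/-- The projection `π : Spin_{m+1} → S^m`, `w ↦ ϑ_{m+1}(w) e₀`. -/
def spinProj (m : ℕ) (w : Spin (m + 1)) : Sph m :=
  ⟨WithLp.toLp 2 ((spinCover (m + 1) w : Matrix (Fin (m + 1)) (Fin (m + 1)) ℝ) *ᵥ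
    (Pi.single 0 1 : Fin (m + 1) → ℝ)), spinProj_mem _⟩

/-- The map `Θ_m = Ψ ∘ ϑ_{m+1} : Spin_{m+1} → SO(S^m)`. -/
def spinFrame (m : ℕ) : Spin (m + 1) → SphereFrame m :=
  fun w => frameOfSO m (spinCover (m + 1) w)

/-! ### Principal bundles and spin structures -/

section Bundles

variable (a b c : ℕ) {G P M : Type*}
  [TopologicalSpace G] [ChartedSpace (EuclideanSpace ℝ (Fin a)) G]
  [TopologicalSpace M] [ChartedSpace (EuclideanSpace ℝ (Fin b)) M]
  [TopologicalSpace P] [ChartedSpace (EuclideanSpace ℝ (Fin c)) P]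

/-- `π : P → M` is a smooth principal `G`-bundle, for the right action `act` of `G` on `P`;
`a`, `b`, `c` are the dimensions of `G`, `M`, `P`. -/
structure IsPrincipalBundle [Group G] (act : P → G → P) (π : P → M) : Prop where
  lieGroup : LieGroup (𝓡 a) ∞ G
  isManifold_base : IsManifold (𝓡 b) ∞ M
  isManifold_total : IsManifold (𝓡 c) ∞ P
  act_one : ∀ p, act p 1 = p
  act_mul : ∀ p g h, act p (g * h) = act (act p g) h
  contMDiff_act : ContMDiff ((𝓡 c).prod (𝓡 a)) (𝓡 c) ∞ fun x : P × G => act x.1 x.2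
  contMDiff_proj : ContMDiff (𝓡 c) (𝓡 b) ∞ π
  surjective_proj : Function.Surjective π
  /-- the action is simply transitive on the fibres of `π`, which it preserves -/
  fibre : ∀ p g, π (act p g) = π p
  simply_transitive : ∀ p q, π p = π q → ∃! g, act p g = q
  /-- `π` is locally trivial, by smooth equivariant trivializations -/
  locally_trivial : ∀ x : M, ∃ e : Bundle.Trivialization G π, x ∈ e.baseSet ∧
    ContMDiffOn (𝓡 c) ((𝓡 b).prod (𝓡 a)) ∞ e e.source ∧
    ContMDiffOn ((𝓡 b).prod (𝓡 a)) (𝓡 c) ∞ e.toOpenPartialHomeomorph.symm e.target ∧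
    ∀ p ∈ e.source, ∀ g, e (act p g) = ((e p).1, (e p).2 * g)

/-- Let `q : F → M` be a bundle of oriented orthonormal frames of an `m`-dimensional manifold,
with its right action `actF` of `SO_m`. A spin structure is a principal `Spin_m`-bundle
`π : P → M` with a smooth twofold covering map `Θ : P → F` over `M` that is equivariant
along `ϑ_m : Spin_m → SO_m`. -/
structure IsSpinStructure (m : ℕ) [ChartedSpace (EuclideanSpace ℝ (Fin a)) (Spin m)]
    {F : Type*} [TopologicalSpace F] [ChartedSpace (EuclideanSpace ℝ (Fin c)) F]
    (q : F → M) (actF : F → SO m → F)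
    (act : P → Spin m → P) (π : P → M) (Θ : P → F) : Prop where
  principal : IsPrincipalBundle a b c act π
  isManifold_frame : IsManifold (𝓡 c) ∞ F
  covering : IsCoveringMap Θ
  two_fold : ∀ y : F, (Θ ⁻¹' {y}).ncard = 2
  local_diffeo : IsLocalDiffeomorph (𝓡 c) (𝓡 c) ∞ Θ
  over_base : ∀ p, q (Θ p) = π p
  equivariant : ∀ p s, Θ (act p s) = actF (Θ p) (spinCover m s)

end Bundles

/-! ### Smooth structures as embedded submanifolds -/

/-- The charts of `X` form a smooth `d`-dimensional manifold structure for which `j : X → V` is a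
smooth embedding into the vector space `V`. For a given `j`, there is at most one such smooth
structure, that of an embedded submanifold. -/
structure IsSubmanifoldStructure (d : ℕ) {X V : Type*} [TopologicalSpace X]
    [ChartedSpace (EuclideanSpace ℝ (Fin d)) X] [NormedAddCommGroup V] [NormedSpace ℝ V]
    (j : X → V) : Prop where
  isManifold : IsManifold (𝓡 d) ∞ X
  isSmoothEmbedding : Manifold.IsSmoothEmbedding (𝓡 d) 𝓘(ℝ, V) ∞ j

end

/-! ### Clifford algebra: the inclusion `Cl_m → Cl_{m+1}` and the twisted centre -/

/-! Reading a matrix as its columns identifies `SO_{m+1}` with the frame bundle, with the first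
column as foot point and right multiplication by `diag(1, A)` as the action of `SO_m`. Everything
therefore reduces to statements about `ϑ`.

Algebra. The kernel of `ϑ_n` consists of even elements commuting with all vectors. An element of
this kind is a scalar (`exists_algebraMap_eq_of_vec_mul`), and unitarity makes it `±1`.
Cartan–Dieudonné writes each special orthogonal matrix as a product of reflections, which lifts to a
product of unit vectors, so `ϑ_n` is onto (`spinCover_surjective`). Since `ϑ_{m+1} ∘ ι` is `A ↦
diag(1, A)` after `ϑ_m`, and `-1` lies in the image of `ι`, the stabiliser of `e₀` in `Spin_{m+1}`
is exactly `ι(Spin_m)` (`exists_spinIncl_eq`). Hence the fibres of `π` are the cosets of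
`ι(Spin_m)`.

Analysis. The products of the rotors `cos t + sin t e_i e_j` parametrize `Spin_n` near `1`. Composed
with `ϑ_n` and with the skew-symmetric part of a matrix, this parametrization has derivative `4 ·
id`. The inverse function theorem then gives charts of `SO_n` and `Spin_n` at once, in which `ϑ_n`
is the identity (`exists_base_charts`). Left translation moves them everywhere. They extend to the
ambient vector spaces, hence define embedded submanifolds
(`isSubmanifoldStructure_of_isSliceChart`), and maps into these are smooth as soon as they are
smooth into the ambient space. Thus `Θ_m` is a local diffeomorphism; as `ϑ_{m+1}` is then an open
surjective homomorphism with kernel of order two, it is a twofold covering.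

Local triviality. For `y ≠ -x` the rotation taking `x` to `y` lifts to the product of the unit
vectors along `x + y` and `x`. This is a smooth local section of `π`, and translating it by
`ι(Spin_m)` trivializes `π` over the complement of `-x` (`exists_smooth_trivialization`). -/

theorem vec_mul_self (n : ℕ) (v : Fin n → ℝ) :
    vec n v * vec n v = algebraMap ℝ (Cl n) (-(v ⬝ᵥ v)) := by
  rw [CliffordAlgebra.ι_sq_scalar, cliffordForm_apply]

theorem vec_mul_vec_comm (n : ℕ) (v w : Fin n → ℝ) :
    vec n v * vec n w = algebraMap ℝ (Cl n) (-(2 * (v ⬝ᵥ w))) - vec n w * vec n v := by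
  rw [CliffordAlgebra.ι_mul_ι_comm, QuadraticMap.polar, cliffordForm_apply, cliffordForm_apply,
    cliffordForm_apply, add_dotProduct, dotProduct_add, dotProduct_add, dotProduct_comm w v]
  congr 2
  ring

theorem vec_single_zero_mul_self (m : ℕ) :
    vec (m + 1) (Pi.single 0 1) * vec (m + 1) (Pi.single 0 1) = -1 := by
  rw [vec_mul_self, single_dotProduct]
  simp

theorem clIncl_vec (m : ℕ) (v : Fin m → ℝ) : clIncl m (vec m v) = vec (m + 1) (Fin.cons 0 v) :=
  CliffordAlgebra.map_apply_ι _ _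

/-- `e₀` is orthogonal to `ℝ^m`, so it anticommutes with each of its vectors; the signs accumulate
to the grading automorphism. In particular `e₀` commutes with even elements, which is why `Spin_m`
will fix it. -/
theorem vec_single_zero_mul_clIncl (m : ℕ) (a : Cl m) :
    vec (m + 1) (Pi.single 0 1) * clIncl m a =
      clIncl m (CliffordAlgebra.involute a) * vec (m + 1) (Pi.single 0 1) := by
  induction a using CliffordAlgebra.induction with
  | algebraMap r => simp only [AlgHom.commutes, Algebra.commutes]
  | ι v =>
    rw [CliffordAlgebra.involute_ι, map_neg, clIncl_vec, vec_mul_vec_comm, single_dotProduct]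
    simp
  | mul a b ha hb =>
    rw [map_mul, ← mul_assoc, ha, mul_assoc, hb, map_mul, map_mul, mul_assoc]
  | add a b ha hb => rw [map_add, mul_add, ha, hb, map_add, map_add, add_mul]

theorem vec_cons_eq (m : ℕ) (v : Fin (m + 1) → ℝ) :
    vec (m + 1) v = v 0 • vec (m + 1) (Pi.single 0 1) + clIncl m (vec m (Fin.tail v)) := by
  rw [clIncl_vec, ← map_smul, ← map_add]
  congr 1
  ext i
  refine Fin.cases ?_ (fun j => ?_) i <;> simp [Fin.tail]

theorem exists_eq_clIncl_add (m : ℕ) (x : Cl (m + 1)) :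
    ∃ a b : Cl m, x = clIncl m a + vec (m + 1) (Pi.single 0 1) * clIncl m b := by
  induction x using CliffordAlgebra.left_induction with
  | algebraMap r => exact ⟨algebraMap ℝ _ r, 0, by simp⟩
  | add x y hx hy =>
    obtain ⟨a, b, rfl⟩ := hx
    obtain ⟨c, d, rfl⟩ := hy
    exact ⟨a + c, b + d, by rw [map_add, map_add, mul_add]; abel⟩
  | ι_mul x v hx =>
    obtain ⟨a, b, rfl⟩ := hx
    -- The witnesses come from expanding `(v₀ e₀ + v')(a + e₀ b)` with `e₀² = -1` and `v' e₀ = -e₀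
    -- v'`.
    refine ⟨vec m (Fin.tail v) * a - v 0 • b, v 0 • a - vec m (Fin.tail v) * b, ?_⟩
    have hanti := vec_single_zero_mul_clIncl m (vec m (Fin.tail v))
    rw [CliffordAlgebra.involute_ι, map_neg] at hanti
    change vec (m + 1) v * _ = _
    rw [vec_cons_eq]
    have h1 : clIncl m (vec m (Fin.tail v)) * (vec (m + 1) (Pi.single 0 1) * clIncl m b) =
        -(vec (m + 1) (Pi.single 0 1) * (clIncl m (vec m (Fin.tail v)) * clIncl m b)) := by
      rw [← mul_assoc, ← mul_assoc, hanti, neg_mul, neg_mul, neg_neg]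
    rw [add_mul, mul_add, mul_add, h1, smul_mul_assoc, smul_mul_assoc, ← mul_assoc,
      vec_single_zero_mul_self, neg_one_mul, map_sub, map_sub, map_mul, map_mul, map_smul, map_smul,
      mul_sub, mul_smul_comm, smul_neg]
    abel

/-- The representation of `Cl_{m+1}` on `2 × 2`-matrices over `Cl_m` with
`(t, x) ↦ !![x, -t; t, -x]`. -/
noncomputable def clMatrix (m : ℕ) : Cl (m + 1) →ₐ[ℝ] Matrix (Fin 2) (Fin 2) (Cl m) :=
  CliffordAlgebra.lift (cliffordForm (m + 1))
    ⟨{ toFun := fun v => !![vec m (Fin.tail v), -algebraMap ℝ _ (v 0);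
          algebraMap ℝ _ (v 0), -vec m (Fin.tail v)]
       map_add' := by
         intro v w
         have : Fin.tail (v + w) = Fin.tail v + Fin.tail w := rfl
         ext i j
         fin_cases i <;> fin_cases j <;> simp [this, add_comm]
       map_smul' := by
         intro c v
         have : Fin.tail (c • v) = c • Fin.tail v := rfl
         ext i j
         fin_cases i <;> fin_cases j <;> simp [this, Algebra.algebraMap_eq_smul_one, smul_smul] }, by
      intro v
      have h := vec_mul_self m (Fin.tail v)
      have h2 : v ⬝ᵥ v = v 0 * v 0 + Fin.tail v ⬝ᵥ Fin.tail v := by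
        simp [dotProduct, Fin.sum_univ_succ, Fin.tail]
      rw [cliffordForm_apply, h2]
      ext i j
      fin_cases i <;> fin_cases j <;>
        simp [Matrix.mul_apply, Fin.sum_univ_two, h, Matrix.algebraMap_matrix_apply,
          Algebra.commutes, add_comm]⟩

/-- The upper left entry recovers `a`. This makes `ι` injective and, being linear, gives a smooth
inverse of `ι` on its image, used later for the fibre coordinate of the trivializations. -/
theorem clMatrix_clIncl (m : ℕ) (a : Cl m) :
    clMatrix m (clIncl m a) = !![a, 0; 0, CliffordAlgebra.involute a] := by
  induction a using CliffordAlgebra.induction with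
  | algebraMap r =>
    rw [AlgHom.commutes, AlgHom.commutes]
    ext i j
    fin_cases i <;> fin_cases j <;> simp [Matrix.algebraMap_matrix_apply]
  | ι v =>
    rw [clIncl_vec, clMatrix, CliffordAlgebra.lift_ι_apply]
    ext i j
    fin_cases i <;> fin_cases j <;> simp
  | mul a b ha hb =>
    rw [map_mul, map_mul, ha, hb]
    ext i j
    fin_cases i <;> fin_cases j <;> simp [Matrix.mul_apply, Fin.sum_univ_two]
  | add a b ha hb =>
    rw [map_add, map_add, ha, hb]
    ext i j
    fin_cases i <;> fin_cases j <;> simp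

/-- A linear left inverse of `clIncl`. -/
noncomputable def clRetract (m : ℕ) : Cl (m + 1) →ₗ[ℝ] Cl m where
  toFun x := clMatrix m x 0 0
  map_add' x y := by simp
  map_smul' c x := by simp

theorem clRetract_clIncl (m : ℕ) (a : Cl m) : clRetract m (clIncl m a) = a := by
  change clMatrix m (clIncl m a) 0 0 = a
  rw [clMatrix_clIncl]
  rfl

theorem clIncl_injective (m : ℕ) : Function.Injective (clIncl m) :=
  Function.LeftInverse.injective (clRetract_clIncl m)

theorem spinIncl_injective (m : ℕ) : Function.Injective (spinIncl m) := fun _ _ h =>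
  Subtype.ext (clIncl_injective m (congrArg Subtype.val h))

/-- The twisted centre is computed by induction on the dimension: testing against `e₀` removes the
part `e₀ b` of `x = a + e₀ b`, and testing against the remaining vectors puts `a` in the twisted
centre of `Cl_m`. -/
theorem exists_algebraMap_eq_of_vec_mul {n : ℕ} (x : Cl n)
    (hx : ∀ v, vec n v * x = CliffordAlgebra.involute x * vec n v) :
    ∃ r : ℝ, algebraMap ℝ (Cl n) r = x := by
  induction n with
  | zero =>
    clear hx
    induction x using CliffordAlgebra.left_induction with
    | algebraMap r => exact ⟨r, rfl⟩
    | add x y hx hy =>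
      obtain ⟨r, rfl⟩ := hx
      obtain ⟨s, rfl⟩ := hy
      exact ⟨r + s, map_add _ _ _⟩
    | ι_mul x v hx => exact ⟨0, by rw [Subsingleton.elim v 0, map_zero, map_zero, zero_mul]⟩
  | succ m ih =>
    obtain ⟨a, b, rfl⟩ := exists_eq_clIncl_add m x
    -- The part `a` satisfies the relation with `e₀` automatically. For the other part it reads `e₀
    -- e₀ b = -e₀ e₀ b`, that is `-b = b`.
    have hb : clIncl m b = 0 := by
      have h := hx (Pi.single 0 1)
      rw [map_add, map_mul, CliffordAlgebra.involute_ι, ← clIncl_involute, ← clIncl_involute,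
        add_mul, mul_add, ← vec_single_zero_mul_clIncl, mul_assoc, ← vec_single_zero_mul_clIncl,
        neg_mul, ← mul_assoc, vec_single_zero_mul_self] at h
      have h2 : (2 : ℝ) • clIncl m b = 0 := by
        rw [two_smul, add_eq_zero_iff_eq_neg]
        simpa using h.symm
      simpa using h2
    rw [hb, mul_zero, add_zero] at hx ⊢
    obtain ⟨r, hr⟩ := ih a fun v => by
      apply clIncl_injective m
      have := hx (Fin.cons 0 v)
      rwa [← clIncl_vec, ← clIncl_involute, ← map_mul, ← map_mul] at this
    exact ⟨r, by rw [← hr, AlgHom.commutes]⟩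

/-! ### Kernel and image of `ϑ_n` -/

theorem Spin.coe_mul_star {n : ℕ} (w : Spin n) : (w : Cl n) * star (w : Cl n) = 1 :=
  spinGroup.coe_mul_star_self w

theorem Spin.coe_inv {n : ℕ} (w : Spin n) : ((w⁻¹ : Spin n) : Cl n) = star (w : Cl n) := rfl

/-- The unit of the Clifford algebra given by a unit vector. -/
noncomputable def unitVec {n : ℕ} (a : Fin n → ℝ) (ha : a ⬝ᵥ a = 1) : (Cl n)ˣ where
  val := vec n a
  inv := -vec n a
  val_inv := by rw [mul_neg, vec_mul_self, ha]; simp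
  inv_val := by rw [neg_mul, vec_mul_self, ha]; simp

theorem unitVec_mem_lipschitzGroup {n : ℕ} (a : Fin n → ℝ) (ha : a ⬝ᵥ a = 1) :
    unitVec a ha ∈ lipschitzGroup (cliffordForm n) :=
  Subgroup.subset_closure ⟨a, rfl⟩

theorem unitVec_mem_unitary {n : ℕ} (a : Fin n → ℝ) (ha : a ⬝ᵥ a = 1) :
    (unitVec a ha : Cl n) ∈ unitary (Cl n) := by
  have h : star (unitVec a ha : Cl n) = ((unitVec a ha)⁻¹ : (Cl n)ˣ) :=
    CliffordAlgebra.star_ι a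
  rw [Unitary.mem_iff, h]
  exact ⟨Units.inv_mul _, Units.mul_inv _⟩

theorem vec_mul_vec_mem_spin {n : ℕ} {a b : Fin n → ℝ} (ha : a ⬝ᵥ a = 1) (hb : b ⬝ᵥ b = 1) :
    vec n a * vec n b ∈ spinGroup (cliffordForm n) :=
  ⟨⟨⟨unitVec a ha * unitVec b hb, mul_mem (unitVec_mem_lipschitzGroup a ha)
    (unitVec_mem_lipschitzGroup b hb), rfl⟩,
    mul_mem (unitVec_mem_unitary a ha) (unitVec_mem_unitary b hb)⟩,
    CliffordAlgebra.ι_mul_ι_mem_evenOdd_zero _ _ _⟩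

/-- `-1 = e₀ e₀` is an even product of unit vectors; this requires dimension at least one, hence the
index `n + 1`. -/
theorem neg_one_mem_spin (n : ℕ) : (-1 : Cl (n + 1)) ∈ spinGroup (cliffordForm (n + 1)) := by
  rw [← vec_single_zero_mul_self]
  exact vec_mul_vec_mem_spin (by simp) (by simp)

/-- The nontrivial element of the kernel of `ϑ_{n+1}`. -/
def spinNegOne (n : ℕ) : Spin (n + 1) := ⟨-1, neg_one_mem_spin n⟩

/-- Such a `w` commutes with all vectors, and being even it equals its image under the grading
automorphism. So it lies in the twisted centre, is a scalar `r`, and `w w* = 1` becomes `r² = 1`. -/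
theorem coe_eq_one_or_neg_one_of_spinCover_eq_one {n : ℕ} {w : Spin n} (hw : spinCover n w = 1) :
    (w : Cl n) = 1 ∨ (w : Cl n) = -1 := by
  obtain ⟨r, hr⟩ := exists_algebraMap_eq_of_vec_mul (w : Cl n) fun v => by
    have h := vec_spinCover_mulVec w v
    rw [hw, Spin.coe_inv, OneMemClass.coe_one, Matrix.one_mulVec] at h
    rw [spinGroup.involute_eq w.2]
    nth_rewrite 1 [h]
    rw [mul_assoc, spinGroup.coe_star_mul_self, mul_one]
  have h := Spin.coe_mul_star w
  rw [← hr, CliffordAlgebra.star_algebraMap, ← map_mul, ← map_one (algebraMap ℝ (Cl n))] at h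
  have h2 := (algebraMap ℝ (Cl n)).injective h
  rcases mul_self_eq_one_iff.mp h2 with rfl | rfl
  · exact Or.inl (by rw [← hr, map_one])
  · exact Or.inr (by rw [← hr, map_neg, map_one])

theorem SO.ext_vec {n : ℕ} {A B : SO n}
    (h : ∀ v, vec n ((A : Matrix (Fin n) (Fin n) ℝ) *ᵥ v)
      = vec n ((B : Matrix (Fin n) (Fin n) ℝ) *ᵥ v)) : A = B := by
  apply Subtype.ext
  apply Matrix.mulVec_injective
  funext v
  exact vec_injective n (h v)

theorem spinCover_spinNegOne (n : ℕ) : spinCover (n + 1) (spinNegOne n) = 1 := by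
  apply SO.ext_vec
  intro v
  rw [vec_spinCover_mulVec, Spin.coe_inv]
  simp [spinNegOne]

theorem spinCover_eq_one_iff {n : ℕ} {w : Spin (n + 1)} :
    spinCover (n + 1) w = 1 ↔ w = 1 ∨ w = spinNegOne n := by
  constructor
  · intro h
    exact (coe_eq_one_or_neg_one_of_spinCover_eq_one h).imp (fun h => Subtype.ext h)
      (fun h => Subtype.ext h)
  · rintro (rfl | rfl)
    · exact map_one _
    · exact spinCover_spinNegOne n

theorem spinNegOne_ne_one (n : ℕ) : spinNegOne n ≠ 1 := by
  intro h
  have h1 : (-1 : Cl (n + 1)) = 1 := congrArg Subtype.val h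
  rw [← map_one (algebraMap ℝ (Cl (n + 1))), ← map_neg] at h1
  have := (algebraMap ℝ (Cl (n + 1))).injective h1
  norm_num at this

theorem dotProduct_self_eq_norm_sq {n : ℕ} (x : EuclideanSpace ℝ (Fin n)) :
    x.ofLp ⬝ᵥ x.ofLp = ‖x‖ ^ 2 := by
  rw [← real_inner_self_eq_norm_sq, EuclideanSpace.inner_eq_star_dotProduct, star_trivial]

/-- Every special orthogonal matrix is a product of reflections along unit vectors. -/
theorem spinCover_surjective (n : ℕ) : Function.Surjective (spinCover n) := by
  intro A
  -- Any product of reflections lifts to a unitary element of the Lipschitz group; parity is left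
  -- open until the determinant is known.
  have key : ∀ l : List (EuclideanSpace ℝ (Fin n)), ∃ x : (Cl n)ˣ,
      x ∈ lipschitzGroup (cliffordForm n) ∧ (x : Cl n) ∈ unitary (Cl n) ∧
      ∀ v : Fin n → ℝ, twistedAd n x v =
        WithLp.ofLp ((l.map fun v => (ℝ ∙ v)ᗮ.reflection).prod (WithLp.toLp 2 v)) := by
    intro l
    induction l with
    | nil =>
      refine ⟨1, one_mem _, one_mem _, fun v => ?_⟩
      apply vec_injective n
      rw [vec_twistedAd n (one_mem _)]
      simp
    | cons a l ih =>
      obtain ⟨x, hx, hxu, hxv⟩ := ih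
      -- The list may contain `0`, whose reflection is the identity and needs no new factor. Other
      -- vectors are normalized so that the factor is unitary.
      by_cases ha : a = 0
      · refine ⟨x, hx, hxu, fun v => ?_⟩
        rw [hxv, ha, List.map_cons, List.prod_cons, LinearIsometryEquiv.coe_mul,
          Function.comp_apply, Submodule.reflection_orthogonal_apply,
          Submodule.reflection_singleton_apply]
        simp
      · have hb : WithLp.ofLp (‖a‖⁻¹ • a) ⬝ᵥ WithLp.ofLp (‖a‖⁻¹ • a) = 1 := by
          have hn : ‖a‖ ≠ 0 := norm_ne_zero_iff.mpr ha
          rw [WithLp.ofLp_smul, smul_dotProduct, dotProduct_smul, dotProduct_self_eq_norm_sq]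
          simp only [smul_eq_mul]
          field_simp
        refine ⟨unitVec _ hb * x, mul_mem (unitVec_mem_lipschitzGroup _ hb) hx,
          mul_mem (unitVec_mem_unitary _ hb) hxu, fun v => ?_⟩
        rw [twistedAd_mul n (unitVec_mem_lipschitzGroup _ hb) hx, LinearMap.comp_apply, hxv,
          (twistedAd_vec n (WithLp.ofLp (‖a‖⁻¹ • a)) rfl _).2, hb, List.map_cons, List.prod_cons,
          LinearIsometryEquiv.coe_mul, Function.comp_apply]
        generalize (l.map fun v => (ℝ ∙ v)ᗮ.reflection).prod (WithLp.toLp 2 v) = y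
        rw [Submodule.reflection_orthogonal_apply, Submodule.reflection_singleton_apply, two_smul,
          EuclideanSpace.inner_eq_star_dotProduct, star_trivial, dotProduct_comm y.ofLp]
        ext i
        simp only [Pi.sub_apply, Pi.smul_apply, WithLp.ofLp_smul, WithLp.ofLp_neg, WithLp.ofLp_sub,
          WithLp.ofLp_add, Pi.add_apply, Pi.neg_apply, smul_dotProduct, smul_eq_mul, RCLike.ofReal_real_eq_id, id_eq]
        have hn : ‖a‖ ≠ 0 := norm_ne_zero_iff.mpr ha
        field_simp
        ring
  have hA := A.2
  rw [Matrix.mem_specialOrthogonalGroup_iff, Matrix.mem_orthogonalGroup_iff'] at hA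
  let L : EuclideanSpace ℝ (Fin n) →ₗᵢ[ℝ] EuclideanSpace ℝ (Fin n) :=
    { toLinearMap := Matrix.toEuclideanLin (A : Matrix (Fin n) (Fin n) ℝ)
      norm_map' := fun x => by
        rw [← sq_eq_sq₀ (norm_nonneg _) (norm_nonneg _), ← dotProduct_self_eq_norm_sq,
          ← dotProduct_self_eq_norm_sq]
        change (A.1 *ᵥ x.ofLp) ⬝ᵥ (A.1 *ᵥ x.ofLp) = _
        rw [Matrix.dotProduct_mulVec, Matrix.vecMul_mulVec, hA.1, Matrix.vecMul_one] }
  -- Cartan–Dieudonné.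
  obtain ⟨l, -, hl⟩ := (L.toLinearIsometryEquiv rfl).reflections_generate_dim
  obtain ⟨x, hx, hxu, hxv⟩ := key l
  rw [← hl] at hxv
  have hT : twistedAd n x = Matrix.toLin' (A : Matrix (Fin n) (Fin n) ℝ) :=
    LinearMap.ext fun v => hxv v
  -- An odd element would act with determinant `-1`.
  have heven : (x : Cl n) ∈ CliffordAlgebra.evenOdd (cliffordForm n) 0 := by
    rcases parity_det_twistedAd n hx with h | h
    · exact h.1
    · rw [hT, LinearMap.det_toLin', hA.2] at h
      norm_num at h
  let w : Spin n := ⟨x, ⟨⟨x, hx, rfl⟩, hxu⟩, heven⟩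
  have hw : spinGroup.toUnits w = x := Units.ext rfl
  refine ⟨w, Subtype.ext ?_⟩
  change LinearMap.toMatrix' (twistedAd n (spinGroup.toUnits w)) = _
  rw [hw, hT, LinearMap.toMatrix'_toLin']

/-! ### Compatibility of `ϑ` with the inclusions -/

theorem blockIncl_mulVec {m : ℕ} (A : Matrix (Fin m) (Fin m) ℝ) (v : Fin (m + 1) → ℝ) :
    blockIncl A *ᵥ v = Fin.cons (v 0) (A *ᵥ Fin.tail v) := by
  ext i
  refine Fin.cases ?_ (fun j => ?_) i <;>
    simp [blockIncl, Matrix.mulVec, dotProduct, Fin.sum_univ_succ, Fin.tail]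

/-- Conjugation by `ι(s)` acts on `ℝ^m` as `s` does, and fixes `e₀` because `s` is even. -/
theorem spinCover_spinIncl {m : ℕ} (s : Spin m) :
    (spinCover (m + 1) (spinIncl m s) : Matrix (Fin (m + 1)) (Fin (m + 1)) ℝ) =
      blockIncl (spinCover m s : Matrix (Fin m) (Fin m) ℝ) := by
  suffices h : spinCover (m + 1) (spinIncl m s) = ⟨_, blockIncl_mem (spinCover m s)⟩ from
    congrArg Subtype.val h
  apply SO.ext_vec
  intro v
  have hinv : ((spinIncl m s)⁻¹ : Spin (m + 1)) = spinIncl m s⁻¹ := (map_inv _ _).symm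
  have hs : ∀ t : Spin m, ((spinIncl m t : Spin (m + 1)) : Cl (m + 1)) = clIncl m (t : Cl m) :=
    fun _ => rfl
  have hss : clIncl m (s : Cl m) * clIncl m ((s⁻¹ : Spin m) : Cl m) = 1 := by
    rw [← map_mul, Spin.coe_inv, Spin.coe_mul_star, map_one]
  have he : clIncl m (s : Cl m) * vec (m + 1) (Pi.single 0 1)
      = vec (m + 1) (Pi.single 0 1) * clIncl m (s : Cl m) := by
    rw [vec_single_zero_mul_clIncl, spinGroup.involute_eq s.2]
  rw [vec_spinCover_mulVec, blockIncl_mulVec, hinv, hs, hs, vec_cons_eq m v,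
    vec_cons_eq m (Fin.cons (v 0) _),
    Fin.cons_zero, Fin.tail_cons, vec_spinCover_mulVec, map_mul, map_mul, mul_add, add_mul,
    mul_smul_comm, smul_mul_assoc, he, mul_assoc (vec _ _), hss, mul_one]

theorem det_blockIncl {m : ℕ} (A : Matrix (Fin m) (Fin m) ℝ) : (blockIncl A).det = A.det := by
  have h : (blockIncl A).submatrix (Fin.succAbove 0) Fin.succ = A := by
    ext i j
    simp [blockIncl]
  rw [Matrix.det_succ_column_zero, Fin.sum_univ_succ, h, Finset.sum_eq_zero fun i _ => ?_]
  · simp [blockIncl]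
  · simp [blockIncl]

/-- By orthogonality `Aᵀ` fixes `e₀` as well, so both the first column and the first row of `A` are
`e₀`. -/
theorem exists_blockIncl_eq {m : ℕ} (A : SO (m + 1))
    (hA : (A : Matrix (Fin (m + 1)) (Fin (m + 1)) ℝ) *ᵥ Pi.single 0 1 = Pi.single 0 1) :
    ∃ B : SO m, blockIncl (B : Matrix (Fin m) (Fin m) ℝ) = A := by
  obtain ⟨A, hA'⟩ := A
  rw [Matrix.mem_specialOrthogonalGroup_iff, Matrix.mem_orthogonalGroup_iff] at hA'
  change A *ᵥ _ = _ at hA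
  have hA2 : Aᵀ *ᵥ Pi.single 0 1 = Pi.single 0 1 := by
    nth_rewrite 1 [← hA]
    rw [Matrix.mulVec_mulVec, mul_eq_one_comm.mp hA'.1, Matrix.one_mulVec]
  have hblock : blockIncl (A.submatrix Fin.succ Fin.succ) = A := by
    rw [Matrix.mulVec_single_one] at hA hA2
    ext i j
    have h1 := fun i => congrFun hA i
    have h2 := fun j => congrFun hA2 j
    simp only [Matrix.col_apply, Matrix.transpose_apply] at h1 h2
    refine Fin.cases ?_ (fun i => ?_) i <;> refine Fin.cases ?_ (fun j => ?_) j <;>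
      simp [blockIncl, h1, h2]
  refine ⟨⟨A.submatrix Fin.succ Fin.succ, ?_⟩, hblock⟩
  rw [Matrix.mem_specialOrthogonalGroup_iff, Matrix.mem_orthogonalGroup_iff, ← det_blockIncl,
    hblock]
  refine ⟨?_, hA'.2⟩
  ext i j
  have h := congrFun (congrFun hA'.1 i.succ) j.succ
  rw [← hblock, Matrix.mul_apply, Fin.sum_univ_succ] at h
  simpa [Matrix.mul_apply, blockIncl, Matrix.one_apply] using h

/-- The stabiliser of `e₀` is `Spin_m`. -/
theorem exists_spinIncl_eq {m : ℕ} {w : Spin (m + 2)}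
    (hw : (spinCover (m + 2) w : Matrix (Fin (m + 2)) (Fin (m + 2)) ℝ) *ᵥ Pi.single 0 1
      = Pi.single 0 1) : ∃ s : Spin (m + 1), spinIncl (m + 1) s = w := by
  obtain ⟨B, hB⟩ := exists_blockIncl_eq _ hw
  obtain ⟨s, rfl⟩ := spinCover_surjective (m + 1) B
  rw [← spinCover_spinIncl] at hB
  have h1 : spinCover (m + 2) ((spinIncl (m + 1) s)⁻¹ * w) = 1 := by
    rw [map_mul, map_inv, inv_mul_eq_one]
    exact Subtype.ext hB
  rcases spinCover_eq_one_iff.mp h1 with h | h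
  · exact ⟨s, inv_mul_eq_one.mp h⟩
  -- The lift `s` is only determined up to sign; if the wrong one was chosen, the sign is corrected
  -- inside `Spin_{m+1}`, which contains `-1`.
  · refine ⟨s * spinNegOne m, ?_⟩
    have h2 : spinIncl (m + 1) (spinNegOne m) = spinNegOne (m + 1) :=
      Subtype.ext (show clIncl (m + 1) (-1) = -1 by rw [map_neg, map_one])
    rw [map_mul, h2, ← h, mul_inv_cancel_left]

/-! ### Smooth structures from charts that extend to the ambient space -/

section SliceCharts

open Set Topology

/-- The inverse function theorem, with a smooth inverse on an open set. -/
theorem exists_openPartialHomeomorph_of_contDiffOn {E F : Type*} [NormedAddCommGroup E]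
    [NormedSpace ℝ E] [CompleteSpace E] [NormedAddCommGroup F] [NormedSpace ℝ F] {f : E → F}
    {U : Set E} (hU : IsOpen U) (hf : ContDiffOn ℝ ∞ f U) {a : E} (ha : a ∈ U) {f' : E ≃L[ℝ] F}
    (hf' : HasFDerivAt f (f' : E →L[ℝ] F) a) :
    ∃ e : OpenPartialHomeomorph E F, a ∈ e.source ∧ e.source ⊆ U ∧ (e : E → F) = f ∧
      ContDiffOn ℝ ∞ e.symm e.target := by
  have hfa : ContDiffAt ℝ ∞ f a := hf.contDiffAt (hU.mem_nhds ha)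
  have hcont : ContinuousOn (fderiv ℝ f) U := hf.continuousOn_fderiv_of_isOpen hU (by simp)
  -- The set where the derivative is invertible is open. Restricting to it makes the inverse smooth
  -- at every point of the target and not only at the image of `a`.
  let O : Set E := U ∩ fderiv ℝ f ⁻¹' range ((↑) : (E ≃L[ℝ] F) → E →L[ℝ] F)
  have hO : IsOpen O := hcont.isOpen_inter_preimage hU ContinuousLinearEquiv.isOpen
  have haO : a ∈ O := ⟨ha, ⟨f', hf'.fderiv.symm⟩⟩
  let e₀ := hfa.toOpenPartialHomeomorph f hf' (by simp)
  have ha₀ : a ∈ e₀.source := hfa.mem_toOpenPartialHomeomorph_source hf' (by simp)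
  refine ⟨e₀.restrOpen O hO, ⟨ha₀, haO⟩, fun x hx => hx.2.1, rfl, fun y hy => ?_⟩
  have hx : (e₀.restrOpen O hO).symm y ∈ (e₀.restrOpen O hO).source :=
    (e₀.restrOpen O hO).map_target hy
  obtain ⟨g, hg⟩ := hx.2.2
  have hc : ContDiffAt ℝ ∞ f ((e₀.restrOpen O hO).symm y) := hf.contDiffAt (hU.mem_nhds hx.2.1)
  refine ((e₀.restrOpen O hO).contDiffAt_symm (f₀' := g) hy ?_ hc).contDiffWithinAt
  rw [hg]
  exact (hc.differentiableAt (by simp)).hasFDerivAt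

variable {d : ℕ} {X V : Type*} [TopologicalSpace X] [NormedAddCommGroup V] [NormedSpace ℝ V]

/-- A chart of a subspace `j : X → V` of a vector space that is the restriction of a smooth map on
an open subset of `V`, and has a smooth inverse. -/
structure IsSliceChart (j : X → V) (e : OpenPartialHomeomorph X (EuclideanSpace ℝ (Fin d))) :
    Prop where
  contDiffOn_symm : ContDiffOn ℝ ∞ (j ∘ e.symm) e.target
  exists_extension : ∃ (W : Set V) (ψ : V → EuclideanSpace ℝ (Fin d)), IsOpen W ∧
    ContDiffOn ℝ ∞ ψ W ∧ ∀ x ∈ e.source, j x ∈ W ∧ ψ (j x) = e x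

namespace IsSliceChart

variable {j : X → V}

/-- The transition is `ψ' ∘ (j ∘ e⁻¹)`, with `ψ'` the ambient extension of `e'`: a composition of
smooth maps between vector spaces. -/
theorem contDiffOn_transition {e e' : OpenPartialHomeomorph X (EuclideanSpace ℝ (Fin d))}
    (he : IsSliceChart j e) (he' : IsSliceChart j e') :
    ContDiffOn ℝ ∞ (e.symm ≫ₕ e') (e.symm ≫ₕ e').source := by
  obtain ⟨W, ψ, -, hψ, h⟩ := he'.exists_extension
  have hs : (e.symm ≫ₕ e').source ⊆ e.target := fun x hx => hx.1
  refine (hψ.comp (he.contDiffOn_symm.mono hs) fun x hx => (h _ hx.2).1).congr fun x hx => ?_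
  exact ((h _ hx.2).2).symm

/-- Transport of charts along a homeomorphism that extends to the ambient spaces. -/
theorem homeomorph {Y V' : Type*} [TopologicalSpace Y] [NormedAddCommGroup V'] [NormedSpace ℝ V']
    {j' : Y → V'} (h : Y ≃ₜ X) {L : V → V'} {L' : V' → V} (hL : ContDiff ℝ ∞ L)
    (hL' : ContDiff ℝ ∞ L') (hj' : ∀ y, j' y = L (j (h y))) (hj : ∀ y, j (h y) = L' (j' y))
    {e : OpenPartialHomeomorph X (EuclideanSpace ℝ (Fin d))} (he : IsSliceChart j e) :
    IsSliceChart j' (h.transOpenPartialHomeomorph e) where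
  contDiffOn_symm := by
    refine (hL.comp_contDiffOn he.contDiffOn_symm).congr fun u hu => ?_
    change j' (h.symm (e.symm u)) = L (j (e.symm u))
    rw [hj', h.apply_symm_apply]
  exists_extension := by
    obtain ⟨W, ψ, hW, hψ, h1⟩ := he.exists_extension
    refine ⟨L' ⁻¹' W, ψ ∘ L', hW.preimage hL'.continuous,
      hψ.comp hL'.contDiffOn fun _ h => h, fun y hy => ?_⟩
    have := h1 (h y) hy
    rw [hj] at this
    exact this

end IsSliceChart

/-- The charted space whose atlas consists of all slice charts. -/
noncomputable abbrev sliceChartedSpace (j : X → V)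
    (h : ∀ x, ∃ e : OpenPartialHomeomorph X (EuclideanSpace ℝ (Fin d)),
      IsSliceChart j e ∧ x ∈ e.source) : ChartedSpace (EuclideanSpace ℝ (Fin d)) X where
  atlas := {e | IsSliceChart j e}
  chartAt x := (h x).choose
  mem_chart_source x := (h x).choose_spec.2
  chart_mem_atlas x := (h x).choose_spec.1

/-- The slice charts define the smooth structure of an embedded submanifold. -/
theorem isSubmanifoldStructure_of_isSliceChart [FiniteDimensional ℝ V]
    [ChartedSpace (EuclideanSpace ℝ (Fin d)) X] {j : X → V} (hj : IsEmbedding j)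
    (h : ∀ e ∈ atlas (EuclideanSpace ℝ (Fin d)) X, IsSliceChart j e) :
    IsSubmanifoldStructure d j := by
  have hman : IsManifold (𝓡 d) ∞ X := by
    refine isManifold_of_contDiffOn _ _ _ fun e e' he he' => ?_
    simpa using (h e he).contDiffOn_transition (h e' he')
  refine ⟨hman, ?_, hj⟩
  -- The complement of the tangent space varies with `x`, whereas an immersion has one model
  -- complement. All of them have dimension `finrank V - d`, so a Euclidean space of that dimension
  -- serves.
  suffices hx : ∀ x, ∃ F : Submodule ℝ V,
      Manifold.IsImmersionAtOfComplement F (𝓡 d) 𝓘(ℝ, V) ∞ j x by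
    refine Manifold.IsImmersionOfComplement.isImmersion
      (F := EuclideanSpace ℝ (Fin (Module.finrank ℝ V - d))) fun x => ?_
    obtain ⟨F, hF⟩ := hx x
    have h1 := hF.equiv.toLinearEquiv.finrank_eq
    rw [Module.finrank_prod, finrank_euclideanSpace_fin] at h1
    exact hF.trans_F (ContinuousLinearEquiv.ofFinrankEq (by rw [finrank_euclideanSpace_fin]; omega))
  intro x
  set e := chartAt (EuclideanSpace ℝ (Fin d)) x with he
  have hxe : x ∈ e.source := mem_chart_source _ x
  have hsl := h e (chart_mem_atlas _ x)
  set f := j ∘ e.symm with hf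
  have hu : e x ∈ e.target := e.map_source hxe
  have hfx : HasFDerivAt f (fderiv ℝ f (e x)) (e x) :=
    ((hsl.contDiffOn_symm.contDiffAt (e.open_target.mem_nhds hu)).differentiableAt
      (by simp)).hasFDerivAt
  -- The ambient extension `ψ` of the chart satisfies `ψ ∘ f = id` near `e x`, so its derivative is
  -- a left inverse of that of `f`.
  have hinj : Function.Injective (fderiv ℝ f (e x)) := by
    obtain ⟨W, ψ, hW, hψ, hψe⟩ := hsl.exists_extension
    have hψx : HasFDerivAt ψ (fderiv ℝ ψ (f (e x))) (f (e x)) := by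
      refine ((hψ.contDiffAt (hW.mem_nhds ?_)).differentiableAt (by simp)).hasFDerivAt
      exact (hψe _ (e.map_target hu)).1
    have hid : (ψ ∘ f) =ᶠ[𝓝 (e x)] id := by
      filter_upwards [e.open_target.mem_nhds hu] with u hu
      exact ((hψe _ (e.map_target hu)).2).trans (e.right_inv hu)
    have hcomp := (hψx.comp _ hfx).unique ((hasFDerivAt_id _).congr_of_eventuallyEq hid)
    intro v w hvw
    have := congrArg (fderiv ℝ ψ (f (e x))) hvw
    have h2 := fun v => DFunLike.congr_fun hcomp v
    simp only [ContinuousLinearMap.comp_apply, ContinuousLinearMap.id_apply] at h2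
    rwa [h2, h2] at this
  obtain ⟨F, hF⟩ := Submodule.exists_isCompl (LinearMap.range (fderiv ℝ f (e x)).toLinearMap)
  let B : (EuclideanSpace ℝ (Fin d) × F) ≃L[ℝ] V :=
    (((LinearEquiv.ofInjective (fderiv ℝ f (e x)).toLinearMap hinj).prodCongr
      (LinearEquiv.refl ℝ F)).trans (Submodule.prodEquivOfIsCompl _ _ hF)).toContinuousLinearEquiv
  have hB : ∀ p, B p = fderiv ℝ f (e x) p.1 + p.2 := fun _ => rfl
  -- Thickening `f` along a complement `F` of its tangent space gives a local diffeomorphism onto an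
  -- open set of `V`. Its inverse flattens the image of `j` to `F = 0`.
  let Φ : EuclideanSpace ℝ (Fin d) × F → V := fun p => f p.1 + p.2
  have hΦ : ContDiffOn ℝ ∞ Φ (Prod.fst ⁻¹' e.target) :=
    (hsl.contDiffOn_symm.comp contDiff_fst.contDiffOn fun _ h => h).add
      (F.subtypeL.contDiff.comp contDiff_snd).contDiffOn
  have hΦ' : HasFDerivAt Φ (B : EuclideanSpace ℝ (Fin d) × F →L[ℝ] V) (e x, 0) := by
    have h1 : HasFDerivAt (fun p : EuclideanSpace ℝ (Fin d) × F => f p.1)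
        ((fderiv ℝ f (e x)).comp (ContinuousLinearMap.fst ℝ _ F)) (e x, 0) :=
      HasFDerivAt.comp (x := ((e x, 0) : EuclideanSpace ℝ (Fin d) × F)) (g := f) hfx
        (hasFDerivAt_fst)
    have h2 : HasFDerivAt (fun p : EuclideanSpace ℝ (Fin d) × F => (p.2 : V))
        (F.subtypeL.comp (ContinuousLinearMap.snd ℝ (EuclideanSpace ℝ (Fin d)) F)) (e x, 0) :=
      (F.subtypeL.comp (ContinuousLinearMap.snd ℝ (EuclideanSpace ℝ (Fin d)) F)).hasFDerivAt
    exact (h1.add h2).congr_fderiv (ContinuousLinearMap.ext fun p => (hB p).symm)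
  obtain ⟨P, hP, hPs, hPΦ, hPsymm⟩ := exists_openPartialHomeomorph_of_contDiffOn
    (e.open_target.preimage continuous_fst) hΦ (a := (e x, 0)) hu hΦ'
  -- The chart is shrunk so that its slice `F = 0` stays inside the domain of the flattening map.
  let S : Set X := {y | (e y, (0 : F)) ∈ P.source}
  have hS : IsOpen (e.source ∩ S) :=
    e.continuousOn.prodMk continuousOn_const |>.isOpen_inter_preimage e.open_source P.open_source
  have hPf : ∀ u, P (u, 0) = f u := fun u => by simp [hPΦ, Φ]
  refine ⟨F, Manifold.IsImmersionAtOfComplement.mk_of_continuousAt hj.continuous.continuousAt B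
    (e.restr (e.source ∩ S)) (P.symm ≫ₕ B.toHomeomorph.toOpenPartialHomeomorph) ?_ ?_
    (restr_mem_maximalAtlas _ (IsManifold.chart_mem_maximalAtlas x) hS) ?_ ?_⟩
  · rw [e.restr_source, hS.interior_eq]
    exact ⟨hxe, hxe, hP⟩
  · have := P.map_source hP
    rw [hPf] at this
    simpa [f, e.left_inv hxe] using this
  · apply StructureGroupoid.mem_maximalAtlas_of_mem_groupoid
    rw [contDiffGroupoid, mem_groupoid_of_pregroupoid]
    constructor
    · have := B.contDiff.comp_contDiffOn hPsymm
      simpa [contDiffPregroupoid, Function.comp_def] using this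
    · have h1 : ContDiffOn ℝ ∞ P P.source := by
        rw [hPΦ]
        exact hΦ.mono hPs
      have := h1.comp (t := P.source) (B.symm.contDiff.contDiffOn (s := B.symm ⁻¹' P.source))
        fun _ h => h
      simpa [contDiffPregroupoid, Function.comp_def] using this
  · intro u hu
    have hu' : u ∈ e.target ∧ (u, (0 : F)) ∈ P.source := by
      rw [OpenPartialHomeomorph.extend_target] at hu
      have h1 : u ∈ (e.restr (e.source ∩ S)).target := by simpa using hu
      have h2 := (e.restr (e.source ∩ S)).map_target h1
      rw [e.restr_source, hS.interior_eq] at h2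
      refine ⟨h1.1, ?_⟩
      have h3 : (e (e.symm u), (0 : F)) ∈ P.source := h2.2.2
      rwa [e.right_inv h1.1] at h3
    change B (P.symm (j ((e.restr (e.source ∩ S)).symm u))) = B (u, 0)
    congr 1
    rw [show j ((e.restr (e.source ∩ S)).symm u) = f u from rfl, ← hPf, P.left_inv hu'.2]

end SliceCharts

/-! ### Smoothness of the Clifford product -/

section CliffordSmooth

open Topology

/-- The product of the Clifford algebra as a continuous bilinear map. -/
noncomputable def clMulL (n : ℕ) : Cl n →L[ℝ] Cl n →L[ℝ] Cl n :=
  (LinearMap.mul ℝ (Cl n)).toContinuousBilinearMap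

theorem ContDiff.cl_mul {n : ℕ} {E : Type*} [NormedAddCommGroup E] [NormedSpace ℝ E]
    {k : WithTop ℕ∞} {f g : E → Cl n} (hf : ContDiff ℝ k f) (hg : ContDiff ℝ k g) :
    ContDiff ℝ k fun x => f x * g x :=
  (clMulL n).isBoundedBilinearMap.contDiff.comp (hf.prodMk hg)

instance Cl.continuousMul (n : ℕ) : ContinuousMul (Cl n) :=
  ⟨(clMulL n).isBoundedBilinearMap.continuous⟩

theorem LinearMap.contDiff_of_finiteDimensional {E F : Type*} [NormedAddCommGroup E]
    [NormedSpace ℝ E] [FiniteDimensional ℝ E] [NormedAddCommGroup F] [NormedSpace ℝ F]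
    {k : WithTop ℕ∞} (f : E →ₗ[ℝ] F) : ContDiff ℝ k f :=
  f.toContinuousLinearMap.contDiff

/-- The conjugation of the Clifford algebra as a linear map. -/
def clStar (n : ℕ) : Cl n →ₗ[ℝ] Cl n where
  toFun := star
  map_add' := star_add
  map_smul' := CliffordAlgebra.star_smul

theorem contDiff_cl_star (n : ℕ) {k : WithTop ℕ∞} : ContDiff ℝ k (star : Cl n → Cl n) :=
  (clStar n).contDiff_of_finiteDimensional

instance Spin.isTopologicalGroup (n : ℕ) : IsTopologicalGroup (Spin n) where
  continuous_inv := continuous_induced_rng.mpr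
    ((contDiff_cl_star n (k := 0)).continuous.comp continuous_subtype_val)

/-- The map `x ↦ (v ↦ x v x*)` on `Cl_n`, which extends `ϑ_n`. -/
noncomputable def spinMatrix (n : ℕ) (x : Cl n) : Fin n → Fin n → ℝ := fun i j =>
  vecPart n (x * vec n (Pi.single j 1) * star x) i

theorem contDiff_spinMatrix (n : ℕ) {k : WithTop ℕ∞} : ContDiff ℝ k (spinMatrix n) := by
  refine contDiff_pi.mpr fun i => contDiff_pi.mpr fun j => ?_
  exact ((LinearMap.proj i).comp (vecPart n)).contDiff_of_finiteDimensional.comp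
    ((contDiff_id.cl_mul contDiff_const).cl_mul (contDiff_cl_star n))

/-- The inclusion of `SO_n` into the vector space of matrices. -/
def soIncl (n : ℕ) (A : SO n) : Fin n → Fin n → ℝ := (A : Matrix (Fin n) (Fin n) ℝ)

theorem isEmbedding_soIncl (n : ℕ) : IsEmbedding (soIncl n) :=
  IsEmbedding.subtypeVal (X := Matrix (Fin n) (Fin n) ℝ)

/-- On `Spin_n` the inverse is the conjugate `w*`, so `ϑ_n` is the restriction of a quadratic map on
the whole algebra. -/
theorem soIncl_spinCover {n : ℕ} (w : Spin n) :
    soIncl n (spinCover n w) = spinMatrix n (w : Cl n) := by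
  ext i j
  have h := vec_spinCover_mulVec w (Pi.single j 1)
  rw [Matrix.mulVec_single_one, Spin.coe_inv] at h
  rw [spinMatrix, ← h, vecPart_vec]
  rfl

theorem continuous_spinCover (n : ℕ) : Continuous (spinCover n) := by
  rw [(isEmbedding_soIncl n).continuous_iff]
  have : soIncl n ∘ spinCover n = spinMatrix n ∘ Subtype.val := funext soIncl_spinCover
  rw [this]
  exact (contDiff_spinMatrix n (k := 0)).continuous.comp continuous_subtype_val

theorem coe_eq_or_eq_neg_of_spinCover_eq {n : ℕ} {w w' : Spin n}
    (h : spinCover n w = spinCover n w') : (w' : Cl n) = w ∨ (w' : Cl n) = -w := by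
  have h1 : spinCover n (w' * w⁻¹) = 1 := by rw [map_mul, map_inv, h, mul_inv_cancel]
  have h2 : (w' : Cl n) = ((w' * w⁻¹ : Spin n) : Cl n) * w := by
    rw [← Submonoid.coe_mul, inv_mul_cancel_right]
  rcases coe_eq_one_or_neg_one_of_spinCover_eq_one h1 with h | h
  · left; rw [h2, h, one_mul]
  · right; rw [h2, h, neg_one_mul]

end CliffordSmooth

/-! ### Coordinates near the identity -/

section Coordinates

open Topology

attribute [local instance] Matrix.linftyOpNormedRing Matrix.linftyOpNormedAlgebra in
/-- Near the identity, an orthogonal matrix is determined by its skew-symmetric part. -/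
theorem exists_nhds_one_skewPart_injective (n : ℕ) : ∃ B ∈ 𝓝 (1 : Matrix (Fin n) (Fin n) ℝ),
    ∀ A ∈ B, ∀ A' ∈ B, A ∈ Matrix.orthogonalGroup (Fin n) ℝ →
      A' ∈ Matrix.orthogonalGroup (Fin n) ℝ → A - Aᵀ = A' - A'ᵀ → A = A' := by
  -- The radius `2` is what the final estimate needs: `2(‖S - 2‖ + ‖T - 2‖) < 8`.
  refine ⟨{A | ‖A + Aᵀ - 2‖ < 2}, ?_, ?_⟩
  · refine IsOpen.mem_nhds ?_ ?_
    · exact isOpen_lt (f := fun A : Matrix (Fin n) (Fin n) ℝ => ‖A + Aᵀ - 2‖) (by fun_prop)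
        continuous_const
    · simp [one_add_one_eq_two]
  · intro A hA A' hA' ho ho' h
    have h1 := (Matrix.mem_orthogonalGroup_iff _ _).mp ho
    have h2 := (Matrix.mem_orthogonalGroup_iff' _ _).mp ho
    have h1' := (Matrix.mem_orthogonalGroup_iff _ _).mp ho'
    have h2' := (Matrix.mem_orthogonalGroup_iff' _ _).mp ho'
    rw [Set.mem_ofPred_eq] at hA hA'
    set S := A + Aᵀ with hS
    set T := A' + A'ᵀ with hT
    -- For orthogonal `A` the square of the symmetric part is determined by the skew one: `(A + Aᵀ)²
    -- = (A - Aᵀ)² + 4`. It remains to see that the square root near `2` is unique.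
    have hST : S * S = T * T := by
      have e1 : S * S = (A - Aᵀ) * (A - Aᵀ) + 4 := by
        rw [hS, add_mul, mul_add, mul_add, sub_mul, mul_sub, mul_sub, h1, h2]
        have : (4 : Matrix (Fin n) (Fin n) ℝ) = 1 + 1 + 1 + 1 := by norm_num
        rw [this]
        abel
      have e2 : T * T = (A' - A'ᵀ) * (A' - A'ᵀ) + 4 := by
        rw [hT, add_mul, mul_add, mul_add, sub_mul, mul_sub, mul_sub, h1', h2']
        have : (4 : Matrix (Fin n) (Fin n) ℝ) = 1 + 1 + 1 + 1 := by norm_num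
        rw [this]
        abel
      rw [e1, e2, h]
    -- `S² = T²` means that `S + T` anticommutes with `S - T`. Writing `S + T = 4 + small` leaves
    -- `8(S - T)` equal to a small multiple of itself.
    have hD : (8 : ℝ) • (S - T) = -((S - 2 + (T - 2)) * (S - T) + (S - T) * (S - 2 + (T - 2))) := by
      have : (8 : ℝ) • (S - T) = 2 * (S - T) + 2 * (S - T) + (S - T) * 2 + (S - T) * 2 := by
        rw [mul_two, two_mul]
        module
      rw [this]
      have h0 : (S + T) * (S - T) + (S - T) * (S + T) = 0 := by
        simp only [add_mul, mul_add, mul_sub, sub_mul, hST]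
        abel
      rw [← sub_eq_zero, ← h0]
      simp only [add_mul, mul_add, mul_sub, sub_mul]
      abel
    have hn : 8 * ‖S - T‖ ≤ 2 * (‖S - 2‖ + ‖T - 2‖) * ‖S - T‖ := by
      calc 8 * ‖S - T‖ = ‖(8 : ℝ) • (S - T)‖ := by rw [norm_smul]; norm_num
        _ ≤ ‖(S - 2 + (T - 2)) * (S - T)‖ + ‖(S - T) * (S - 2 + (T - 2))‖ := by
          rw [hD, norm_neg]
          exact norm_add_le _ _
        _ ≤ ‖S - 2 + (T - 2)‖ * ‖S - T‖ + ‖S - T‖ * ‖S - 2 + (T - 2)‖ :=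
          add_le_add (norm_mul_le _ _) (norm_mul_le _ _)
        _ = 2 * ‖S - 2 + (T - 2)‖ * ‖S - T‖ := by ring
        _ ≤ 2 * (‖S - 2‖ + ‖T - 2‖) * ‖S - T‖ := by
          gcongr
          exact norm_add_le _ _
    have hz : ‖S - T‖ = 0 := by
      by_contra hne
      have hpos : 0 < ‖S - T‖ := lt_of_le_of_ne (norm_nonneg _) (Ne.symm hne)
      nlinarith
    have hST' : S = T := sub_eq_zero.mp (norm_eq_zero.mp hz)
    have h2A : (2 : ℝ) • A = (2 : ℝ) • A' := by
      have e1 : (2 : ℝ) • A = S + (A - Aᵀ) := by rw [hS, two_smul]; abel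
      have e2 : (2 : ℝ) • A' = T + (A' - A'ᵀ) := by rw [hT, two_smul]; abel
      rw [e1, e2, hST', h]
    exact smul_right_injective _ (two_ne_zero (α := ℝ)) h2A

theorem card_lt_pairs (n : ℕ) :
    Fintype.card {p : Fin n × Fin n // p.1 < p.2} = n.choose 2 := by
  have h : ∀ j : Fin n, (∑ i : Fin n, if i < j then 1 else 0) = (j : ℕ) := fun j => by
    rw [← Finset.card_filter, show Finset.univ.filter (· < j) = Finset.Iio j by ext; simp, Fin.card_Iio]
  rw [Fintype.card_subtype, Finset.card_filter, Fintype.sum_prod_type_right]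
  simp only [h]
  rw [Fin.sum_univ_eq_sum_range (fun i => i), Finset.sum_range_id, Nat.choose_two_right]

/-- An enumeration of the pairs `i < j`. -/
noncomputable def pairEquiv (n : ℕ) : Fin (n.choose 2) ≃ {p : Fin n × Fin n // p.1 < p.2} :=
  (Fintype.equivFinOfCardEq (card_lt_pairs n)).symm

/-- The coordinates `A_{ji} - A_{ij}` for `i < j` of a matrix. -/
noncomputable def skewCoord (n : ℕ) (A : Fin n → Fin n → ℝ) :
    EuclideanSpace ℝ (Fin (n.choose 2)) :=
  WithLp.toLp 2 fun k => A (pairEquiv n k).1.2 (pairEquiv n k).1.1 -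
    A (pairEquiv n k).1.1 (pairEquiv n k).1.2

theorem contDiff_skewCoord (n : ℕ) {k : WithTop ℕ∞} : ContDiff ℝ k (skewCoord n) := by
  rw [contDiff_euclidean]
  intro l
  exact ((contDiff_apply_apply ℝ ℝ _ _).sub (contDiff_apply_apply ℝ ℝ _ _))

theorem sub_transpose_eq_of_skewCoord_eq {n : ℕ} {A A' : Matrix (Fin n) (Fin n) ℝ}
    (h : skewCoord n A = skewCoord n A') : A - Aᵀ = A' - A'ᵀ := by
  have key : ∀ i j, i < j → A j i - A i j = A' j i - A' i j := by
    intro i j hij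
    have := congrArg (fun v => v.ofLp ((pairEquiv n).symm ⟨(i, j), hij⟩)) h
    simpa [skewCoord] using this
  ext i j
  simp only [Matrix.sub_apply, Matrix.transpose_apply]
  rcases lt_trichotomy i j with h | rfl | h
  · linarith [key i j h]
  · simp
  · exact key j i h

/-- The rotor `cos t + sin t e_i e_j`. -/
noncomputable def spinRotor {n : ℕ} (p : {p : Fin n × Fin n // p.1 < p.2}) (t : ℝ) : Spin n :=
  ⟨vec n (Pi.single p.1.1 1) *
    vec n (-Real.cos t • Pi.single p.1.1 1 + Real.sin t • Pi.single p.1.2 1),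
    vec_mul_vec_mem_spin (by simp) (by
      have := p.2.ne
      simp [this, this.symm, ← sq])⟩

theorem coe_spinRotor {n : ℕ} (p : {p : Fin n × Fin n // p.1 < p.2}) (t : ℝ) :
    (spinRotor p t : Cl n) = Real.cos t • (1 : Cl n) +
      Real.sin t • (vec n (Pi.single p.1.1 1) * vec n (Pi.single p.1.2 1)) := by
  change vec n _ * vec n _ = _
  rw [map_add, map_smul, map_smul, mul_add, mul_smul_comm, mul_smul_comm, vec_mul_self]
  simp

/-- The product of the rotors for all pairs `i < j`. -/
noncomputable def spinParam (n : ℕ) (u : EuclideanSpace ℝ (Fin (n.choose 2))) : Spin n :=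
  ((List.finRange (n.choose 2)).map fun k => spinRotor (pairEquiv n k) (u k)).prod

/-- All factors are `1` at `0`, so by the product rule the derivative there is the sum of the
bivectors `u_k e_i e_j`. The statement is for an arbitrary list to allow induction. -/
theorem contDiff_hasFDerivAt_rotor_prod (n : ℕ) (l : List (Fin (n.choose 2))) :
    ContDiff ℝ ∞ (fun u : EuclideanSpace ℝ (Fin (n.choose 2)) =>
      (((l.map fun k => spinRotor (pairEquiv n k) (u k)).prod : Spin n) : Cl n)) ∧
    ((l.map fun k => spinRotor (pairEquiv n k) 0).prod : Spin n) = 1 ∧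
    ∃ D : EuclideanSpace ℝ (Fin (n.choose 2)) →L[ℝ] Cl n,
      HasFDerivAt (fun u : EuclideanSpace ℝ (Fin (n.choose 2)) =>
        (((l.map fun k => spinRotor (pairEquiv n k) (u k)).prod : Spin n) : Cl n)) D 0 ∧
      ∀ u, D u = (l.map fun k => u k • (vec n (Pi.single (pairEquiv n k).1.1 1) *
        vec n (Pi.single (pairEquiv n k).1.2 1))).sum := by
  have h0 : ∀ p : {p : Fin n × Fin n // p.1 < p.2}, spinRotor p 0 = 1 := fun p =>
    Subtype.ext (by rw [coe_spinRotor]; simp)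
  induction l with
  | nil => exact ⟨contDiff_const, rfl, 0, hasFDerivAt_const _ _, fun _ => rfl⟩
  | cons k l ih =>
    obtain ⟨hc, h1, D, hD, hDu⟩ := ih
    simp only [List.map_cons, List.prod_cons, Submonoid.coe_mul, coe_spinRotor]
    have hk : ContDiff ℝ ∞ fun u : EuclideanSpace ℝ (Fin (n.choose 2)) => u k :=
      (EuclideanSpace.proj (𝕜 := ℝ) k).contDiff
    refine ⟨ContDiff.cl_mul ?_ hc, by rw [h1, h0, one_mul], ?_⟩
    · exact ((Real.contDiff_cos.comp hk).smul (contDiff_const (c := (1 : Cl n)))).add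
        ((Real.contDiff_sin.comp hk).smul (contDiff_const (c := vec n (Pi.single (pairEquiv n k).1.1 1) *
          vec n (Pi.single (pairEquiv n k).1.2 1))))
    · set b := vec n (Pi.single (pairEquiv n k).1.1 1) * vec n (Pi.single (pairEquiv n k).1.2 1)
      have hk' : HasFDerivAt (fun u : EuclideanSpace ℝ (Fin (n.choose 2)) => u k)
        (EuclideanSpace.proj (𝕜 := ℝ) k) 0 := (EuclideanSpace.proj (𝕜 := ℝ) k).hasFDerivAt
      have hr := (hk'.cos.smul_const (1 : Cl n)).add (hk'.sin.smul_const b)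
      refine ⟨_, ContinuousLinearMap.hasFDerivAt_of_bilinear (clMulL n) hr hD, fun u => ?_⟩
      have h2 : ((l.map fun k => spinRotor (pairEquiv n k)
        ((0 : EuclideanSpace ℝ (Fin (n.choose 2))) k)).prod : Spin n) = 1 := h1
      simp only [Pi.add_apply, add_apply,
        ContinuousLinearMap.precompR_apply, ContinuousLinearMap.precompL_apply,
        ContinuousLinearMap.smulRight_apply, smul_apply, h2]
      rw [List.sum_cons, ← hDu]
      simp [clMulL, add_comm, b]

theorem contDiff_spinParam (n : ℕ) : ContDiff ℝ ∞ fun u => (spinParam n u : Cl n) :=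
  (contDiff_hasFDerivAt_rotor_prod n _).1

theorem spinParam_zero (n : ℕ) : spinParam n 0 = 1 := (contDiff_hasFDerivAt_rotor_prod n _).2.1

/-- The commutator with a bivector is an infinitesimal rotation; this computes the derivative of
`ϑ_n` at `1`. -/
theorem vec_mul_vec_commutator {n : ℕ} (a c v : Fin n → ℝ) :
    vec n a * vec n c * vec n v - vec n v * (vec n a * vec n c) =
      vec n ((2 * (a ⬝ᵥ v)) • c - (2 * (c ⬝ᵥ v)) • a) := by
  rw [mul_assoc, vec_mul_vec_comm n c v, mul_sub, ← mul_assoc, ← mul_assoc,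
    vec_mul_vec_comm n a v, sub_mul, ← Algebra.commutes, ← Algebra.smul_def, ← Algebra.smul_def,
    map_sub, map_smul, map_smul, neg_smul, neg_smul]
  abel

/-- The rotation generator of the plane `p` has no component in the plane `q`: the increasing order
excludes the swapped pair. Hence the derivative below is diagonal. -/
theorem single_pair_eq_zero {n : ℕ} {p q : Fin n × Fin n} (hp : p.1 < p.2) (hq : q.1 < q.2)
    (hpq : p ≠ q) :
    ((Pi.single p.1 1 : Fin n → ℝ) q.1 * (Pi.single p.2 1 : Fin n → ℝ) q.2 -
        (Pi.single p.2 1 : Fin n → ℝ) q.1 * (Pi.single p.1 1 : Fin n → ℝ) q.2) -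
      ((Pi.single p.1 1 : Fin n → ℝ) q.2 * (Pi.single p.2 1 : Fin n → ℝ) q.1 -
        (Pi.single p.2 1 : Fin n → ℝ) q.2 * (Pi.single p.1 1 : Fin n → ℝ) q.1) = 0 := by
  obtain ⟨a, c⟩ := p
  obtain ⟨i, j⟩ := q
  have h : (Pi.single a 1 : Fin n → ℝ) i * (Pi.single c 1 : Fin n → ℝ) j = 0 := by
    rw [Pi.single_apply, Pi.single_apply]
    split_ifs with h1 h2 <;> simp_all
  have h' : (Pi.single c 1 : Fin n → ℝ) i * (Pi.single a 1 : Fin n → ℝ) j = 0 := by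
    rw [Pi.single_apply, Pi.single_apply]
    split_ifs with h1 h2
    · subst h1 h2
      exact absurd hp hq.not_gt
    all_goals simp
  linear_combination 2 * h - 2 * h'

/-- The rotor with parameter `t` rotates its plane by `2t`, and the skew coordinate subtracts two
opposite entries `±2t`; hence the factor `4`. -/
theorem hasFDerivAt_skewCoord_spinParam (n : ℕ) :
    HasFDerivAt (fun u => skewCoord n (spinMatrix n (spinParam n u)))
      ((4 : ℝ) • ContinuousLinearMap.id ℝ (EuclideanSpace ℝ (Fin (n.choose 2)))) 0 := by
  obtain ⟨-, -, D, hD, hDu⟩ := contDiff_hasFDerivAt_rotor_prod n (List.finRange (n.choose 2))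
  change HasFDerivAt (fun u => (spinParam n u : Cl n)) D 0 at hD
  simp only [← Fin.sum_univ_def] at hDu
  -- Since `e_i e_j` is anti-selfadjoint for `i ≠ j`, the derivative of `w v w*` at `1` is a
  -- commutator.
  have hstar : ∀ u, star (D u) = -D u := by
    intro u
    rw [hDu, star_sum, ← Finset.sum_neg_distrib]
    refine Finset.sum_congr rfl fun k _ => ?_
    rw [CliffordAlgebra.star_smul, star_mul, CliffordAlgebra.star_ι, CliffordAlgebra.star_ι,
      neg_mul_neg, vec_mul_vec_comm n (Pi.single (pairEquiv n k).1.2 1), single_dotProduct,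
      Pi.single_eq_of_ne (pairEquiv n k).2.ne']
    simp
  have hentry : ∀ i j, HasFDerivAt (fun u => spinMatrix n (spinParam n u) i j)
      (((LinearMap.proj i).comp (vecPart n)).toContinuousLinearMap.comp
        (((clMulL n).flip (vec n (Pi.single j 1)) -
          clMulL n (vec n (Pi.single j 1))).comp D)) 0 := by
    intro i j
    have h1 := ((clMulL n).flip (vec n (Pi.single j 1))).hasFDerivAt.comp
      (0 : EuclideanSpace ℝ (Fin (n.choose 2))) hD
    have h2 := (clStar n).toContinuousLinearMap.hasFDerivAt.comp
      (0 : EuclideanSpace ℝ (Fin (n.choose 2))) hD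
    have h3 := ((LinearMap.proj i).comp (vecPart n)).toContinuousLinearMap.hasFDerivAt.comp
      (0 : EuclideanSpace ℝ (Fin (n.choose 2)))
      (ContinuousLinearMap.hasFDerivAt_of_bilinear (clMulL n) h1 h2)
    refine h3.congr_fderiv (ContinuousLinearMap.ext fun u => ?_)
    have h4 := hstar u
    simp [clMulL, clStar, spinParam_zero, h4, sub_eq_neg_add]
  rw [← hasFDerivWithinAt_univ, hasFDerivWithinAt_euclidean]
  intro k
  rw [hasFDerivWithinAt_univ]
  refine ((hentry _ _).sub (hentry _ _)).congr_fderiv (ContinuousLinearMap.ext fun u => ?_)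
  have hcomm : ∀ j, ((clMulL n).flip (vec n (Pi.single j 1)) - clMulL n (vec n (Pi.single j 1)))
      (D u) = vec n (∑ k, u k • ((2 * (Pi.single (pairEquiv n k).1.1 1 : Fin n → ℝ) j) •
        Pi.single (pairEquiv n k).1.2 1 - (2 * (Pi.single (pairEquiv n k).1.2 1 : Fin n → ℝ) j) •
          Pi.single (pairEquiv n k).1.1 1)) := by
    intro j
    simp only [hDu, map_sum, map_smul]
    refine Finset.sum_congr rfl fun k _ => ?_
    have := vec_mul_vec_commutator (Pi.single (pairEquiv n k).1.1 1)
      (Pi.single (pairEquiv n k).1.2 1) (Pi.single j 1)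
    rw [dotProduct_single, dotProduct_single, mul_one, mul_one] at this
    rw [← this]
    rfl
  simp only [sub_apply, ContinuousLinearMap.comp_apply, hcomm, LinearMap.coe_toContinuousLinearMap',
    LinearMap.comp_apply, LinearMap.proj_apply, vecPart_vec,
    Finset.sum_apply, ← Finset.sum_sub_distrib]
  rw [Finset.sum_eq_single k]
  · have hne := (pairEquiv n k).2.ne
    simp [hne, hne.symm]
    ring
  · intro l _ hlk
    have h := single_pair_eq_zero (pairEquiv n l).2 (pairEquiv n k).2 fun h =>
      hlk ((pairEquiv n).injective (Subtype.ext h))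
    simp only [Pi.smul_apply, Pi.sub_apply, smul_eq_mul]
    linear_combination (2 * u l) * h
  · simp

open Set in
/-- Compatible charts of `SO_n` and `Spin_n` near the identity. -/
theorem exists_base_charts (n : ℕ) :
    ∃ (e₁ : OpenPartialHomeomorph (SO n) (EuclideanSpace ℝ (Fin (n.choose 2))))
      (e₂ : OpenPartialHomeomorph (Spin n) (EuclideanSpace ℝ (Fin (n.choose 2)))),
      1 ∈ e₁.source ∧ 1 ∈ e₂.source ∧ IsSliceChart (soIncl n) e₁ ∧
      IsSliceChart (fun w : Spin n => (w : Cl n)) e₂ ∧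
      ∀ w ∈ e₂.source, spinCover n w ∈ e₁.source ∧ e₁ (spinCover n w) = e₂ w := by
  set E := EuclideanSpace ℝ (Fin (n.choose 2))
  have hFc : ContDiff ℝ ∞ fun u : E => skewCoord n (spinMatrix n (spinParam n u)) :=
    (contDiff_skewCoord n).comp ((contDiff_spinMatrix n).comp (contDiff_spinParam n))
  obtain ⟨h, h0, -, hF, hsymm⟩ := exists_openPartialHomeomorph_of_contDiffOn isOpen_univ
    hFc.contDiffOn (mem_univ (0 : E))
    (f' := ContinuousLinearEquiv.smulLeft (Units.mk0 (4 : ℝ) (by norm_num)))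
    (hasFDerivAt_skewCoord_spinParam n)
  have hF' : ∀ u, h u = skewCoord n (soIncl n (spinCover n (spinParam n u))) := fun u => by
    rw [hF, soIncl_spinCover]
  have hcφ : Continuous (spinParam n) :=
    continuous_induced_rng.mpr (contDiff_spinParam n).continuous
  have hcϑφ : Continuous fun u => spinCover n (spinParam n u) := (continuous_spinCover n).comp hcφ
  have hcψ : Continuous fun A : SO n => skewCoord n (soIncl n A) :=
    (contDiff_skewCoord n (k := 0)).continuous.comp (isEmbedding_soIncl n).continuous
  obtain ⟨B₀, hB₀, hinj⟩ := exists_nhds_one_skewPart_injective n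
  obtain ⟨B₁, hB₁, hB₁o, hB₁1⟩ := mem_nhds_iff.mp hB₀
  let B : Set (SO n) := Subtype.val ⁻¹' B₁
  have hBo : IsOpen B := hB₁o.preimage continuous_subtype_val
  have hB1 : (1 : SO n) ∈ B := hB₁1
  have hBinj : ∀ A ∈ B, ∀ A' ∈ B, skewCoord n (soIncl n A) = skewCoord n (soIncl n A') → A = A' :=
    fun A hA A' hA' hAA => Subtype.ext (hinj _ (hB₁ hA) _ (hB₁ hA')
      (Matrix.mem_specialOrthogonalGroup_iff.mp A.2).1
      (Matrix.mem_specialOrthogonalGroup_iff.mp A'.2).1 (sub_transpose_eq_of_skewCoord_eq hAA))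
  obtain ⟨U₁, U₂, hU₁, hU₂, h1U, h2U, hdisj⟩ :=
    t2_separation (show (1 : Cl n) ≠ -1 by
      intro h
      have h1 : (2 : ℝ) • (1 : Cl n) = 0 := by
        rw [two_smul]
        nth_rewrite 1 [h]
        exact neg_add_cancel _
      simp at h1)
  -- A neighbourhood of `1` that never contains both `w` and `-w`, so that `ϑ_n` is injective on it.
  let N : Set (Spin n) := {w | (w : Cl n) ∈ U₁ ∧ -(w : Cl n) ∈ U₂}
  have hN : IsOpen N := (hU₁.preimage continuous_subtype_val).inter
    (hU₂.preimage continuous_subtype_val.neg)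
  have hN1 : (1 : Spin n) ∈ N := ⟨h1U, h2U⟩
  have hNinj : ∀ w ∈ N, ∀ w' ∈ N, spinCover n w = spinCover n w' → w = w' := by
    intro w hw w' hw' hww
    rcases coe_eq_or_eq_neg_of_spinCover_eq hww with h | h
    · exact Subtype.ext h.symm
    · exact absurd (h ▸ hw'.1) (disjoint_right.mp hdisj hw.2)
  have hg : ContinuousOn (fun A : SO n => h.symm (skewCoord n (soIncl n A)))
      {A | skewCoord n (soIncl n A) ∈ h.target} :=
    h.continuousOn_symm.comp hcψ.continuousOn fun _ hA => hA
  have hO₁ : IsOpen {A : SO n | skewCoord n (soIncl n A) ∈ h.target} := h.open_target.preimage hcψ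
  -- On `T` the map `h` is invertible and the matrices lie in `B`, where skew coordinates are
  -- injective.
  let T : Set E := h.source ∩ (fun u => spinCover n (spinParam n u)) ⁻¹' B
  have hT : IsOpen T := h.open_source.inter (hBo.preimage hcϑφ)
  have hpsi : ∀ A ∈ B, skewCoord n (soIncl n A) ∈ h.target →
      h.symm (skewCoord n (soIncl n A)) ∈ T →
      spinCover n (spinParam n (h.symm (skewCoord n (soIncl n A)))) = A := by
    intro A hA hA2 hA3
    refine hBinj _ hA3.2 _ hA ?_
    rw [← hF', h.right_inv hA2]
  let e₁ : OpenPartialHomeomorph (SO n) E :=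
    { toFun := fun A => h.symm (skewCoord n (soIncl n A))
      invFun := fun u => spinCover n (spinParam n u)
      source := B ∩ ({A | skewCoord n (soIncl n A) ∈ h.target} ∩
        (fun A => h.symm (skewCoord n (soIncl n A))) ⁻¹' T)
      target := T
      map_source' := fun A hA => hA.2.2
      map_target' := fun u hu => by
        have h1 : h.symm (skewCoord n (soIncl n (spinCover n (spinParam n u)))) = u := by
          rw [← hF', h.left_inv hu.1]
        refine ⟨hu.2, ?_, ?_⟩
        · rw [mem_ofPred_eq, ← hF']
          exact h.map_source hu.1
        · rw [mem_preimage, h1]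
          exact hu
      left_inv' := fun A hA => hpsi A hA.1 hA.2.1 hA.2.2
      right_inv' := fun u hu => by rw [← hF', h.left_inv hu.1]
      open_source := hBo.inter (hg.isOpen_inter_preimage hO₁ hT)
      open_target := hT
      continuousOn_toFun := hg.mono fun A hA => hA.2.1
      continuousOn_invFun := hcϑφ.continuousOn }
  have he₁ : ∀ A, e₁ A = h.symm (skewCoord n (soIncl n A)) := fun _ => rfl
  have he₁s : ∀ u, e₁.symm u = spinCover n (spinParam n u) := fun _ => rfl
  let T₂ : Set E := T ∩ spinParam n ⁻¹' N
  have hT₂ : IsOpen T₂ := hT.inter (hN.preimage hcφ)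
  have hgc : ContinuousOn (fun w : Spin n => e₁ (spinCover n w)) (spinCover n ⁻¹' e₁.source) :=
    e₁.continuousOn.comp (continuous_spinCover n).continuousOn fun _ hA => hA
  -- Defined as `e₁ ∘ ϑ_n`, so that `ϑ_n` is the identity in the two charts.
  let e₂ : OpenPartialHomeomorph (Spin n) E :=
    { toFun := fun w => e₁ (spinCover n w)
      invFun := spinParam n
      source := N ∩ (spinCover n ⁻¹' e₁.source ∩ (fun w => e₁ (spinCover n w)) ⁻¹' T₂)
      target := T₂
      map_source' := fun w hw => hw.2.2
      map_target' := fun u hu => by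
        refine ⟨hu.2, e₁.map_target hu.1, ?_⟩
        have h1 : e₁ (spinCover n (spinParam n u)) = u := e₁.right_inv hu.1
        rw [mem_preimage, h1]
        exact hu
      left_inv' := fun w hw => hNinj _ hw.2.2.2 _ hw.1 (e₁.left_inv hw.2.1)
      right_inv' := fun u hu => e₁.right_inv hu.1
      open_source := hN.inter
        (hgc.isOpen_inter_preimage (e₁.open_source.preimage (continuous_spinCover n)) hT₂)
      open_target := hT₂
      continuousOn_toFun := hgc.mono fun w hw => hw.2.1
      continuousOn_invFun := hcφ.continuousOn }
  have hz : h.symm (skewCoord n (soIncl n 1)) = 0 := by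
    have := h.left_inv h0
    rwa [hF', spinParam_zero, map_one] at this
  have hzT : (0 : E) ∈ T := ⟨h0, by rw [mem_preimage, spinParam_zero, map_one]; exact hB1⟩
  have h1s : (1 : SO n) ∈ e₁.source := by
    refine ⟨hB1, ?_, ?_⟩
    · have := h.map_source h0
      rwa [hF', spinParam_zero, map_one] at this
    · rw [mem_preimage, hz]
      exact hzT
  have hψs : ContDiffOn ℝ ∞ (fun A => h.symm (skewCoord n A)) (skewCoord n ⁻¹' h.target) :=
    hsymm.comp (contDiff_skewCoord n).contDiffOn fun _ h => h
  refine ⟨e₁, e₂, h1s, ⟨hN1, ?_, ?_⟩, ⟨?_, ?_⟩, ⟨(contDiff_spinParam n).contDiffOn, ?_⟩,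
    fun w hw => ⟨hw.2.1, rfl⟩⟩
  · rw [mem_preimage, map_one]
    exact h1s
  · rw [mem_preimage, map_one, he₁, hz]
    exact ⟨hzT, by rw [mem_preimage, spinParam_zero]; exact hN1⟩
  · refine ((contDiff_spinMatrix n).comp (contDiff_spinParam n)).contDiffOn.congr fun u _ => ?_
    exact soIncl_spinCover _
  · exact ⟨_, _, h.open_target.preimage (contDiff_skewCoord n (k := 0)).continuous, hψs,
      fun A hA => ⟨hA.2.1, rfl⟩⟩
  · refine ⟨spinMatrix n ⁻¹' (skewCoord n ⁻¹' h.target), _,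
      (h.open_target.preimage (contDiff_skewCoord n (k := 0)).continuous).preimage
        (contDiff_spinMatrix n (k := 0)).continuous,
      hψs.comp (contDiff_spinMatrix n).contDiffOn fun _ h => h, fun w hw => ⟨?_, ?_⟩⟩
    · have := hw.2.1.2.1
      rw [mem_ofPred_eq, soIncl_spinCover] at this
      exact this
    · change h.symm (skewCoord n (spinMatrix n (w : Cl n))) = e₁ (spinCover n w)
      rw [he₁, soIncl_spinCover]

end Coordinates

/-! ### The smooth structures of `Spin_n` and `SO(S^m)` -/

section Structures

open Topology

/-- A chart of `SO_n` near the identity. -/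
noncomputable def soBaseChart (n : ℕ) :
    OpenPartialHomeomorph (SO n) (EuclideanSpace ℝ (Fin (n.choose 2))) :=
  (exists_base_charts n).choose

/-- A chart of `Spin_n` near the identity. -/
noncomputable def spinBaseChart (n : ℕ) :
    OpenPartialHomeomorph (Spin n) (EuclideanSpace ℝ (Fin (n.choose 2))) :=
  (exists_base_charts n).choose_spec.choose

theorem base_charts_spec (n : ℕ) :
    1 ∈ (soBaseChart n).source ∧ 1 ∈ (spinBaseChart n).source ∧
      IsSliceChart (soIncl n) (soBaseChart n) ∧
      IsSliceChart (fun w : Spin n => (w : Cl n)) (spinBaseChart n) ∧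
      ∀ w ∈ (spinBaseChart n).source, spinCover n w ∈ (soBaseChart n).source ∧
        soBaseChart n (spinCover n w) = spinBaseChart n w :=
  (exists_base_charts n).choose_spec.choose_spec

/-- The translate to `w` of the chart of `Spin_n`. -/
noncomputable def spinChart {n : ℕ} (w : Spin n) :
    OpenPartialHomeomorph (Spin n) (EuclideanSpace ℝ (Fin (n.choose 2))) :=
  (Homeomorph.mulLeft w⁻¹).transOpenPartialHomeomorph (spinBaseChart n)

theorem mem_spinChart_source {n : ℕ} (w : Spin n) : w ∈ (spinChart w).source := by
  change w⁻¹ * w ∈ (spinBaseChart n).source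
  rw [inv_mul_cancel]
  exact (base_charts_spec n).2.1

theorem isSliceChart_spinChart {n : ℕ} (w : Spin n) :
    IsSliceChart (fun w : Spin n => (w : Cl n)) (spinChart w) := by
  refine IsSliceChart.homeomorph (Homeomorph.mulLeft w⁻¹) (L := fun x => (w : Cl n) * x)
    (L' := fun x => ((w⁻¹ : Spin n) : Cl n) * x) (contDiff_const.cl_mul contDiff_id)
    (contDiff_const.cl_mul contDiff_id) (fun y => ?_) (fun y => ?_) (base_charts_spec n).2.2.2.1
  · rw [Homeomorph.coe_mulLeft, ← Submonoid.coe_mul, mul_inv_cancel_left]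
  · rfl

noncomputable instance Spin.chartedSpace (n : ℕ) :
    ChartedSpace (EuclideanSpace ℝ (Fin (n.choose 2))) (Spin n) :=
  sliceChartedSpace (fun w : Spin n => (w : Cl n))
    fun w => ⟨spinChart w, isSliceChart_spinChart w, mem_spinChart_source w⟩

theorem Spin.isSubmanifoldStructure (n : ℕ) :
    IsSubmanifoldStructure (n.choose 2) (fun w : Spin n => (w : Cl n)) :=
  isSubmanifoldStructure_of_isSliceChart IsEmbedding.subtypeVal fun _ h => h

/-- Left multiplication by a matrix. -/
def matrixMulLeft {n : ℕ} (A : Matrix (Fin n) (Fin n) ℝ) (B : Fin n → Fin n → ℝ) :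
    Fin n → Fin n → ℝ := fun i j => ∑ k, A i k * B k j

theorem contDiff_matrixMulLeft {n : ℕ} (A : Matrix (Fin n) (Fin n) ℝ) :
    ContDiff ℝ ∞ (matrixMulLeft A) := by
  refine contDiff_pi.mpr fun i => contDiff_pi.mpr fun j => ?_
  exact ContDiff.sum fun k _ => contDiff_const.mul (contDiff_apply_apply ℝ ℝ k j)

theorem soIncl_mul {n : ℕ} (A B : SO n) :
    soIncl n (A * B) = matrixMulLeft (A : Matrix (Fin n) (Fin n) ℝ) (soIncl n B) := by
  ext i j
  exact Matrix.mul_apply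

/-- The linear map that sends a matrix to its columns. -/
def toFrame (m : ℕ) (A : Fin (m + 1) → Fin (m + 1) → ℝ) :
    EuclideanSpace ℝ (Fin (m + 1)) × (Fin m → EuclideanSpace ℝ (Fin (m + 1))) :=
  (column A 0, fun j => column A j.succ)

theorem contDiff_column {n : ℕ} {k : WithTop ℕ∞} (j : Fin n) :
    ContDiff ℝ k fun A : Fin n → Fin n → ℝ => column A j :=
  contDiff_euclidean.mpr fun i => contDiff_apply_apply ℝ ℝ i j

theorem contDiff_toFrame (m : ℕ) {k : WithTop ℕ∞} : ContDiff ℝ k (toFrame m) :=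
  (contDiff_column 0).prodMk (contDiff_pi.mpr fun j => contDiff_column j.succ)

/-- The linear map that sends a list of columns to the matrix. -/
def ofFrame (m : ℕ)
    (x : EuclideanSpace ℝ (Fin (m + 1)) × (Fin m → EuclideanSpace ℝ (Fin (m + 1)))) :
    Fin (m + 1) → Fin (m + 1) → ℝ := fun i j => frameMatrix x.1 x.2 i j

theorem contDiff_ofFrame (m : ℕ) {k : WithTop ℕ∞} : ContDiff ℝ k (ofFrame m) := by
  refine contDiff_pi.mpr fun i => contDiff_pi.mpr fun j => ?_
  refine Fin.cases ?_ (fun j => ?_) j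
  · exact contDiff_euclidean.mp contDiff_fst i
  · exact contDiff_euclidean.mp ((contDiff_apply ℝ _ j).comp contDiff_snd) i

theorem SphereFrame.isEmbedding_incl (m : ℕ) : IsEmbedding (SphereFrame.incl (m := m)) :=
  (IsEmbedding.subtypeVal.prodMap IsEmbedding.id).comp IsEmbedding.subtypeVal

theorem incl_frameOfSO {m : ℕ} (A : SO (m + 1)) :
    (frameOfSO m A).incl = toFrame m (soIncl (m + 1) A) := rfl

/-- The identification `Ψ` is a homeomorphism. -/
def frameHomeo (m : ℕ) : SO (m + 1) ≃ₜ SphereFrame m where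
  toEquiv := frameOfSO m
  continuous_toFun := by
    rw [(SphereFrame.isEmbedding_incl m).continuous_iff]
    exact (contDiff_toFrame m (k := 0)).continuous.comp (isEmbedding_soIncl (m + 1)).continuous
  continuous_invFun := by
    rw [(isEmbedding_soIncl (m + 1)).continuous_iff]
    exact (contDiff_ofFrame m (k := 0)).continuous.comp
      (SphereFrame.isEmbedding_incl m).continuous

/-- The translate to `A` of the chart of `SO_{m+1}`. -/
noncomputable def soChart {n : ℕ} (A : SO n) :
    OpenPartialHomeomorph (SO n) (EuclideanSpace ℝ (Fin (n.choose 2))) :=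
  (Homeomorph.mulLeft A⁻¹).transOpenPartialHomeomorph (soBaseChart n)

theorem isSliceChart_soChart {n : ℕ} (A : SO n) : IsSliceChart (soIncl n) (soChart A) := by
  refine IsSliceChart.homeomorph (Homeomorph.mulLeft A⁻¹)
    (contDiff_matrixMulLeft (A : Matrix (Fin n) (Fin n) ℝ))
    (contDiff_matrixMulLeft ((A⁻¹ : SO n) : Matrix (Fin n) (Fin n) ℝ))
    (fun y => ?_) (fun y => ?_) (base_charts_spec n).2.2.1
  · rw [← soIncl_mul, Homeomorph.coe_mulLeft, mul_inv_cancel_left]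
  · rw [← soIncl_mul, Homeomorph.coe_mulLeft]

/-- The chart of `SO(S^m)` at the frame given by the columns of `A`. -/
noncomputable def frameChart {m : ℕ} (A : SO (m + 1)) :
    OpenPartialHomeomorph (SphereFrame m) (EuclideanSpace ℝ (Fin ((m + 1).choose 2))) :=
  (frameHomeo m).symm.transOpenPartialHomeomorph (soChart A)

theorem isSliceChart_frameChart {m : ℕ} (A : SO (m + 1)) :
    IsSliceChart (SphereFrame.incl (m := m)) (frameChart A) := by
  refine IsSliceChart.homeomorph (frameHomeo m).symm (contDiff_toFrame m)
    (contDiff_ofFrame m) (fun y => ?_) (fun y => rfl) (isSliceChart_soChart A)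
  rw [← incl_frameOfSO]
  exact congrArg SphereFrame.incl ((frameHomeo m).apply_symm_apply y).symm

theorem frameOfSO_mem_frameChart_source {m : ℕ} (A : SO (m + 1)) :
    frameOfSO m A ∈ (frameChart A).source := by
  change A⁻¹ * (frameHomeo m).symm (frameHomeo m A) ∈ (soBaseChart (m + 1)).source
  rw [Homeomorph.symm_apply_apply, inv_mul_cancel]
  exact (base_charts_spec _).1

noncomputable instance SphereFrame.chartedSpace (m : ℕ) :
    ChartedSpace (EuclideanSpace ℝ (Fin ((m + 1).choose 2))) (SphereFrame m) :=
  sliceChartedSpace (SphereFrame.incl (m := m)) fun x =>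
    ⟨frameChart ((frameOfSO m).symm x), isSliceChart_frameChart _, by
      have := frameOfSO_mem_frameChart_source ((frameOfSO m).symm x)
      rwa [Equiv.apply_symm_apply] at this⟩

theorem SphereFrame.isSubmanifoldStructure (m : ℕ) :
    IsSubmanifoldStructure ((m + 1).choose 2) (SphereFrame.incl (m := m)) :=
  isSubmanifoldStructure_of_isSliceChart (SphereFrame.isEmbedding_incl m) fun _ h => h

instance Spin.isManifold (n : ℕ) : IsManifold (𝓡 (n.choose 2)) ∞ (Spin n) :=
  (Spin.isSubmanifoldStructure n).isManifold

instance SphereFrame.isManifold (m : ℕ) :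
    IsManifold (𝓡 ((m + 1).choose 2)) ∞ (SphereFrame m) :=
  (SphereFrame.isSubmanifoldStructure m).isManifold

end Structures

/-! ### Smooth maps into and out of `Spin_n` -/

section SmoothMaps

open Topology

variable {E H M : Type*} [NormedAddCommGroup E] [NormedSpace ℝ E] [TopologicalSpace H]
  {I : ModelWithCorners ℝ E H} [TopologicalSpace M] [ChartedSpace H M]

/-- A map into an embedded submanifold is smooth if it is smooth into the ambient space. -/
theorem IsSubmanifoldStructure.contMDiffAt {d : ℕ} {X V : Type*} [TopologicalSpace X]
    [ChartedSpace (EuclideanSpace ℝ (Fin d)) X] [NormedAddCommGroup V] [NormedSpace ℝ V]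
    {j : X → V} (hj : IsSubmanifoldStructure d j) {f : M → X} {x : M}
    (hf : ContMDiffAt I 𝓘(ℝ, V) ∞ (fun y => j (f y)) x) : ContMDiffAt I (𝓡 d) ∞ f x := by
  have := hj.isManifold
  rw [ContMDiffAt.iff_comp_isImmersionAt (hj.isSmoothEmbedding.isImmersion.isImmersionAt (f x))]
  exact ⟨hj.isSmoothEmbedding.isEmbedding.continuousAt_iff.mpr hf.continuousAt, hf⟩

theorem Spin.contMDiff_coe (n : ℕ) :
    ContMDiff (𝓡 (n.choose 2)) 𝓘(ℝ, Cl n) ∞ fun w : Spin n => (w : Cl n) :=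
  (Spin.isSubmanifoldStructure n).isSmoothEmbedding.contMDiff

theorem ContMDiffAt.cl_mul {n : ℕ} {f g : M → Cl n} {x : M}
    (hf : ContMDiffAt I 𝓘(ℝ, Cl n) ∞ f x) (hg : ContMDiffAt I 𝓘(ℝ, Cl n) ∞ g x) :
    ContMDiffAt I 𝓘(ℝ, Cl n) ∞ (fun y => f y * g y) x :=
  ((contDiff_fst.cl_mul contDiff_snd).contMDiff (x := (f x, g x))).comp x (hf.prodMk_space hg)

instance Spin.lieGroup (n : ℕ) : LieGroup (𝓡 (n.choose 2)) ∞ (Spin n) where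
  contMDiff_mul x := (Spin.isSubmanifoldStructure n).contMDiffAt
    (((Spin.contMDiff_coe n).comp contMDiff_fst x).cl_mul
      ((Spin.contMDiff_coe n).comp contMDiff_snd x))
  contMDiff_inv x := (Spin.isSubmanifoldStructure n).contMDiffAt
    ((contDiff_cl_star n).contMDiff.comp (Spin.contMDiff_coe n) x)

theorem contMDiff_spin_act (m : ℕ) :
    ContMDiff ((𝓡 ((m + 1).choose 2)).prod (𝓡 (m.choose 2))) (𝓡 ((m + 1).choose 2)) ∞
      fun x : Spin (m + 1) × Spin m => x.1 * spinIncl m x.2 := fun x =>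
  (Spin.isSubmanifoldStructure (m + 1)).contMDiffAt
    (((Spin.contMDiff_coe _).comp contMDiff_fst x).cl_mul
      (((clIncl m).toLinearMap.contDiff_of_finiteDimensional.contMDiff.comp
        (Spin.contMDiff_coe m)).comp contMDiff_snd x))

theorem contMDiff_spinProj (m : ℕ) :
    ContMDiff (𝓡 ((m + 1).choose 2)) (𝓡 m) ∞ (spinProj m) := by
  have := Fact.mk (@finrank_euclideanSpace_fin ℝ _ (m + 1))
  refine ContMDiff.codRestrict_sphere (E := EuclideanSpace ℝ (Fin (m + 1))) (f := fun w : Spin (m + 1) => WithLp.toLp 2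
    ((spinCover (m + 1) w : Matrix (Fin (m + 1)) (Fin (m + 1)) ℝ) *ᵥ
    (Pi.single 0 1 : Fin (m + 1) → ℝ))) ?_ _
  have h : (fun w : Spin (m + 1) => WithLp.toLp 2
      ((spinCover (m + 1) w : Matrix (Fin (m + 1)) (Fin (m + 1)) ℝ) *ᵥ
      (Pi.single 0 1 : Fin (m + 1) → ℝ))) =
      fun w : Spin (m + 1) => column (spinMatrix (m + 1) (w : Cl (m + 1))) 0 := by
    funext w
    rw [← soIncl_spinCover, Matrix.mulVec_single_one]
    rfl
  rw [h]
  exact ((contDiff_column 0).comp (contDiff_spinMatrix (m + 1))).contMDiff.comp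
    (Spin.contMDiff_coe (m + 1))

/-- In the charts translated by `w` and `ϑ(w)` the map is the identity, because `ϑ` is a
homomorphism and intertwines the charts at `1`. -/
theorem isLocalDiffeomorph_spinFrame (m : ℕ) :
    IsLocalDiffeomorph (𝓡 ((m + 1).choose 2)) (𝓡 ((m + 1).choose 2)) ∞ (spinFrame m) := by
  intro w
  have hs : spinChart w ∈ IsManifold.maximalAtlas (𝓡 ((m + 1).choose 2)) ∞ (Spin (m + 1)) :=
    IsManifold.subset_maximalAtlas (isSliceChart_spinChart w)
  have hf : frameChart (spinCover (m + 1) w) ∈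
      IsManifold.maximalAtlas (𝓡 ((m + 1).choose 2)) ∞ (SphereFrame m) :=
    IsManifold.subset_maximalAtlas (isSliceChart_frameChart _)
  have hcomm : ∀ v ∈ (spinChart w).source,
      spinFrame m v ∈ (frameChart (spinCover (m + 1) w)).source ∧
        frameChart (spinCover (m + 1) w) (spinFrame m v) = spinChart w v := by
    intro v hv
    have h := (base_charts_spec (m + 1)).2.2.2.2 (w⁻¹ * v) hv
    have h2 : (spinCover (m + 1) w)⁻¹ * (frameHomeo m).symm (spinFrame m v) =
        spinCover (m + 1) (w⁻¹ * v) := by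
      rw [map_mul, map_inv]
      congr 1
      exact (frameHomeo m).symm_apply_apply _
    rw [← h2] at h
    exact h
  let e := spinChart w ≫ₕ (frameChart (spinCover (m + 1) w)).symm
  refine ⟨⟨e.toPartialEquiv, e.open_source, e.open_target, ?_, ?_⟩, ?_, ?_⟩
  · exact (contMDiffOn_symm_of_mem_maximalAtlas hf).comp
      ((contMDiffOn_of_mem_maximalAtlas hs).mono fun x hx => hx.1) fun x hx => hx.2
  · exact (contMDiffOn_symm_of_mem_maximalAtlas hs).comp
      ((contMDiffOn_of_mem_maximalAtlas hf).mono fun x hx => hx.1) fun x hx => hx.2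
  · refine ⟨mem_spinChart_source w, ?_⟩
    have := hcomm w (mem_spinChart_source w)
    change spinChart w w ∈ (frameChart (spinCover (m + 1) w)).target
    rw [← this.2]
    exact (frameChart (spinCover (m + 1) w)).map_source this.1
  · intro v hv
    have := hcomm v hv.1
    change _ = (frameChart (spinCover (m + 1) w)).symm (spinChart w v)
    rw [← this.2, (frameChart (spinCover (m + 1) w)).left_inv this.1]

end SmoothMaps

/-! ### The covering `Θ` -/

section Covering

open Topology

theorem isOpenMap_spinCover (m : ℕ) : IsOpenMap (spinCover (m + 1)) := by
  have h : (spinCover (m + 1) : Spin (m + 1) → SO (m + 1)) =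
      (frameHomeo m).symm ∘ spinFrame m :=
    funext fun w => ((frameHomeo m).symm_apply_apply _).symm
  rw [h]
  exact (frameHomeo m).symm.isOpenMap.comp (isLocalDiffeomorph_spinFrame m).isOpenMap

/-- An open surjective continuous homomorphism is the quotient by its kernel, which is finite and
hence discrete. -/
theorem isCoveringMap_spinFrame (m : ℕ) : IsCoveringMap (spinFrame m) := by
  have hker : ((spinCover (m + 1)).ker : Set (Spin (m + 1))).Finite := by
    refine (Set.toFinite {1, spinNegOne m}).subset fun w hw => ?_
    exact spinCover_eq_one_iff.mp hw
  have hq : IsQuotientMap (spinCover (m + 1)) :=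
    (isOpenMap_spinCover m).isQuotientMap (continuous_spinCover _) (spinCover_surjective _)
  exact (hq.isQuotientCoveringMap_of_isDiscrete_ker_monoidHom
    hker.isDiscrete).isCoveringMap.homeomorph_comp (frameHomeo m)

theorem ncard_spinFrame_fibre (m : ℕ) (y : SphereFrame m) :
    (spinFrame m ⁻¹' {y}).ncard = 2 := by
  obtain ⟨w, hw⟩ := spinCover_surjective (m + 1) ((frameOfSO m).symm y)
  have h : spinFrame m ⁻¹' {y} = {w, w * spinNegOne m} := by
    ext v
    have h1 : spinFrame m v = y ↔ spinCover (m + 1) (w⁻¹ * v) = 1 := by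
      rw [spinFrame, ← Equiv.eq_symm_apply, ← hw, map_mul, map_inv, inv_mul_eq_one, eq_comm]
    rw [Set.mem_preimage, Set.mem_singleton_iff, h1, spinCover_eq_one_iff, inv_mul_eq_one,
      inv_mul_eq_iff_eq_mul, eq_comm (a := w)]
    rfl
  rw [h, Set.ncard_pair]
  intro h
  exact spinNegOne_ne_one m (left_eq_mul.mp h)

end Covering

/-! ### The principal bundle `Spin_{m+1} → S^m` -/

section Sections

open Topology

theorem star_vec_mul_vec {n : ℕ} (a b : Fin n → ℝ) :
    star (vec n a * vec n b) = vec n b * vec n a := by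
  rw [star_mul, CliffordAlgebra.star_ι, CliffordAlgebra.star_ι, neg_mul_neg]

/-- The product of the unit vectors along `p + q` and `p` rotates `p` to `q`. -/
theorem vec_rotation {n : ℕ} {p q z : Fin n → ℝ} {c : ℝ} (hp : p ⬝ᵥ p = 1) (hq : q ⬝ᵥ q = 1)
    (hz : z = c • (q + p)) (hzz : z ⬝ᵥ z = 1) :
    vec n z * vec n p * vec n p * star (vec n z * vec n p) = vec n q := by
  -- Reflection along `p` sends `p` to `-p`, and reflection along `z` sends `-p` to `-p + 2⟨z, p⟩
  -- z`. This identity says that the result is `q`.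
  have hzp : (2 * (z ⬝ᵥ p)) • z = q + p := by
    have h1 : c * c * (2 * (1 + q ⬝ᵥ p)) = 1 := by
      refine Eq.trans ?_ hzz
      rw [hz, smul_dotProduct, dotProduct_smul, add_dotProduct, dotProduct_add,
        dotProduct_add, hp, hq, dotProduct_comm p q]
      simp only [smul_eq_mul]
      ring
    have h2 : z ⬝ᵥ p = c * (1 + q ⬝ᵥ p) := by
      rw [hz, smul_dotProduct, add_dotProduct, hp, smul_eq_mul, add_comm]
    rw [h2, hz, smul_smul, show 2 * (c * (1 + q ⬝ᵥ p)) * c = 1 by linarith, one_smul]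
  rw [star_vec_mul_vec, mul_assoc (vec n z), vec_mul_self, hp, ← Algebra.commutes, mul_assoc,
    ← mul_assoc (vec n z), vec_mul_vec_comm n z p, sub_mul, mul_assoc (vec n p), vec_mul_self, hzz]
  simp only [map_neg, map_one, neg_mul, mul_neg, one_mul, mul_one]
  rw [← Algebra.smul_def, ← map_smul, hzp, map_add]
  abel

theorem vec_spinProj {m : ℕ} (w : Spin (m + 1)) :
    vec (m + 1) (spinProj m w : EuclideanSpace ℝ (Fin (m + 1))).ofLp =
      (w : Cl (m + 1)) * vec (m + 1) (Pi.single 0 1) * ((w⁻¹ : Spin (m + 1)) : Cl (m + 1)) :=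
  vec_spinCover_mulVec w (Pi.single 0 1)

theorem Sph.ext_vec {m : ℕ} {x y : Sph m}
    (h : vec (m + 1) (x : EuclideanSpace ℝ (Fin (m + 1))).ofLp =
      vec (m + 1) (y : EuclideanSpace ℝ (Fin (m + 1))).ofLp) : x = y :=
  Subtype.ext (WithLp.ofLp_injective 2 (vec_injective _ h))

theorem Sph.dotProduct_self {m : ℕ} (x : Sph m) :
    (x : EuclideanSpace ℝ (Fin (m + 1))).ofLp ⬝ᵥ (x : EuclideanSpace ℝ (Fin (m + 1))).ofLp = 1 := by
  rw [dotProduct_self_eq_norm_sq, norm_eq_of_mem_sphere, one_pow]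

/-- `π(w w') = ϑ(w) π(w')` depends on `w'` only through `π(w')`. -/
theorem spinProj_mul {m : ℕ} {w w' v : Spin (m + 1)} (h : spinProj m w' = spinProj m v) :
    spinProj m (w * w') = spinProj m (w * v) := by
  apply Sph.ext_vec
  have h1 := congrArg (fun x : Sph m => vec (m + 1) (x : EuclideanSpace ℝ (Fin (m + 1))).ofLp) h
  simp only [vec_spinProj] at h1
  simp only [vec_spinProj, mul_inv_rev, Submonoid.coe_mul]
  calc _ = (w : Cl (m + 1)) * ((w' : Cl (m + 1)) * vec (m + 1) (Pi.single 0 1) * ((w'⁻¹ : Spin (m + 1)) : Cl _)) *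
        ((w⁻¹ : Spin (m + 1)) : Cl _) := by simp only [mul_assoc]
    _ = _ := by rw [h1]; simp only [mul_assoc]

theorem spinProj_one (m : ℕ) :
    (spinProj m 1 : EuclideanSpace ℝ (Fin (m + 1))).ofLp = Pi.single 0 1 := by
  change (spinCover (m + 1) 1).1 *ᵥ Pi.single 0 1 = _
  rw [map_one]
  exact Matrix.one_mulVec _

theorem spinProj_eq_one_iff {m : ℕ} (w : Spin (m + 1)) : spinProj m w = spinProj m 1 ↔
    (spinCover (m + 1) w : Matrix (Fin (m + 1)) (Fin (m + 1)) ℝ) *ᵥ Pi.single 0 1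
      = Pi.single 0 1 := by
  rw [Subtype.ext_iff, ← (WithLp.ofLp_injective 2).eq_iff, spinProj_one]
  rfl

theorem spinProj_spinIncl {m : ℕ} (s : Spin m) :
    spinProj m (spinIncl m s) = spinProj m 1 := by
  rw [spinProj_eq_one_iff, spinCover_spinIncl, blockIncl_mulVec]
  ext i
  refine Fin.cases ?_ (fun j => ?_) i
  · simp
  · have : Fin.tail (Pi.single 0 1 : Fin (m + 1) → ℝ) = 0 := by
      ext j
      simp [Fin.tail]
    simp [this]

theorem spinProj_act {m : ℕ} (w : Spin (m + 1)) (s : Spin m) :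
    spinProj m (w * spinIncl m s) = spinProj m w := by
  rw [spinProj_mul (spinProj_spinIncl s), mul_one]

theorem exists_act_eq {m : ℕ} (hm : m ≠ 0) {w w' : Spin (m + 1)}
    (h : spinProj m w = spinProj m w') : ∃ s : Spin m, w * spinIncl m s = w' := by
  obtain ⟨k, rfl⟩ := Nat.exists_eq_succ_of_ne_zero hm
  obtain ⟨s, hs⟩ := exists_spinIncl_eq (m := k) (w := w⁻¹ * w')
    ((spinProj_eq_one_iff _).mp (by rw [spinProj_mul h.symm, inv_mul_cancel]))
  exact ⟨s, by rw [hs, mul_inv_cancel_left]⟩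

/-- The unit vector along `y + x`. -/
noncomputable def midVec {m : ℕ} (x y : Sph m) : EuclideanSpace ℝ (Fin (m + 1)) :=
  ‖(y : EuclideanSpace ℝ (Fin (m + 1))) + x‖⁻¹ • ((y : EuclideanSpace ℝ (Fin (m + 1))) + x)

theorem midVec_dotProduct_self {m : ℕ} {x y : Sph m}
    (h : (y : EuclideanSpace ℝ (Fin (m + 1))) + x ≠ 0) :
    (midVec x y).ofLp ⬝ᵥ (midVec x y).ofLp = 1 := by
  have hn := norm_ne_zero_iff.mpr h
  rw [dotProduct_self_eq_norm_sq, midVec, norm_smul, norm_inv, norm_norm, inv_mul_cancel₀ hn,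
    one_pow]

open Classical in
/-- The rotation of `x` to `y`, lifted to the spin group. -/
noncomputable def spinRotation {m : ℕ} (x y : Sph m) : Spin (m + 1) :=
  if h : (y : EuclideanSpace ℝ (Fin (m + 1))) + x ≠ 0 then
    ⟨_, vec_mul_vec_mem_spin (midVec_dotProduct_self h) (Sph.dotProduct_self x)⟩
  else 1

theorem coe_spinRotation {m : ℕ} {x y : Sph m}
    (h : (y : EuclideanSpace ℝ (Fin (m + 1))) + x ≠ 0) :
    (spinRotation x y : Cl (m + 1)) = vec (m + 1) (midVec x y).ofLp *
      vec (m + 1) (x : EuclideanSpace ℝ (Fin (m + 1))).ofLp := by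
  rw [spinRotation, dif_pos h]

theorem spinProj_spinRotation_mul {m : ℕ} {x y : Sph m} {w : Spin (m + 1)}
    (hw : spinProj m w = x) (h : (y : EuclideanSpace ℝ (Fin (m + 1))) + x ≠ 0) :
    spinProj m (spinRotation x y * w) = y := by
  apply Sph.ext_vec
  have h1 := vec_spinProj w
  rw [hw] at h1
  rw [vec_spinProj, mul_inv_rev, Submonoid.coe_mul, Submonoid.coe_mul]
  calc _ = (spinRotation x y : Cl (m + 1)) * (w * vec (m + 1) (Pi.single 0 1) *
        ((w⁻¹ : Spin (m + 1)) : Cl (m + 1))) * ((spinRotation x y)⁻¹ : Spin (m + 1)) := by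
        simp only [mul_assoc]
    _ = _ := by
      rw [← h1, Spin.coe_inv, coe_spinRotation h]
      exact vec_rotation (Sph.dotProduct_self x) (Sph.dotProduct_self y) rfl
        (midVec_dotProduct_self h)

theorem spinProj_surjective {m : ℕ} (hm : m ≠ 0) : Function.Surjective (spinProj m) := by
  intro y
  by_cases h : (y : EuclideanSpace ℝ (Fin (m + 1))) + (spinProj m 1) = 0
  · obtain ⟨k, rfl⟩ : ∃ k, m = k + 1 := Nat.exists_eq_succ_of_ne_zero hm
    -- The antipode `-e₀` is the one point that `spinRotation` does not reach from `e₀`; the half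
    -- turn `e₀ e₁` does, which requires a second basis vector.
    refine ⟨⟨_, vec_mul_vec_mem_spin (a := Pi.single 0 1) (b := Pi.single 1 1)
      (by simp) (by simp)⟩, ?_⟩
    apply Sph.ext_vec
    rw [eq_neg_of_add_eq_zero_left h, vec_spinProj, Spin.coe_inv, WithLp.ofLp_neg, spinProj_one,
      map_neg, star_vec_mul_vec]
    have hc := vec_mul_vec_comm (k + 1 + 1) (Pi.single 0 1) (Pi.single 1 1)
    have e0 := vec_single_zero_mul_self (k + 1)
    have e1 := vec_mul_self (k + 1 + 1) (Pi.single 1 1)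
    rw [single_dotProduct] at e1 hc
    simp only [Pi.single_eq_same, mul_one, map_neg, map_one] at e1
    rw [Pi.single_eq_of_ne (by simp)] at hc
    simp only [mul_zero, neg_zero, map_zero, zero_sub] at hc
    set a := vec (k + 1 + 1) (Pi.single 0 1)
    set b := vec (k + 1 + 1) (Pi.single 1 1)
    calc a * b * a * (b * a) = a * b * (a * b) * a := by simp only [mul_assoc]
      _ = -(a * (b * b) * (a * a)) := by
        nth_rewrite 2 [hc]
        simp only [mul_neg, neg_mul, mul_assoc]
      _ = -a := by rw [e0, e1]; simp
  · exact ⟨_, spinProj_spinRotation_mul (w := 1) rfl h⟩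

theorem contMDiffAt_spinRotation {m : ℕ} {x y : Sph m}
    (h : (y : EuclideanSpace ℝ (Fin (m + 1))) + x ≠ 0) :
    ContMDiffAt (𝓡 m) (𝓡 ((m + 1).choose 2)) ∞ (spinRotation x) y := by
  have := Fact.mk (@finrank_euclideanSpace_fin ℝ _ (m + 1))
  have hcoe : ContMDiff (𝓡 m) 𝓘(ℝ, EuclideanSpace ℝ (Fin (m + 1))) ∞
      ((↑) : Sph m → EuclideanSpace ℝ (Fin (m + 1))) := contMDiff_coe_sphere
  refine (Spin.isSubmanifoldStructure (m + 1)).contMDiffAt ?_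
  have hmid : ContMDiffAt (𝓡 m) 𝓘(ℝ, EuclideanSpace ℝ (Fin (m + 1))) ∞ (midVec x) y := by
    have h1 : ContDiffAt ℝ ∞ (fun z : EuclideanSpace ℝ (Fin (m + 1)) =>
        ‖z + x‖⁻¹ • (z + (x : EuclideanSpace ℝ (Fin (m + 1)))))
        (y : EuclideanSpace ℝ (Fin (m + 1))) := by
      have h2 : ContDiffAt ℝ ∞ (fun z : EuclideanSpace ℝ (Fin (m + 1)) =>
          z + (x : EuclideanSpace ℝ (Fin (m + 1)))) (y : EuclideanSpace ℝ (Fin (m + 1))) :=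
        contDiffAt_id.add contDiffAt_const
      exact ((h2.norm ℝ h).inv (norm_ne_zero_iff.mpr h)).smul h2
    exact h1.contMDiffAt.comp y (hcoe y)
  have hL : ContDiff ℝ ∞ fun z : EuclideanSpace ℝ (Fin (m + 1)) => vec (m + 1) z.ofLp :=
    ((vec (m + 1)).comp (WithLp.linearEquiv 2 ℝ (Fin (m + 1) → ℝ)).toLinearMap
      ).contDiff_of_finiteDimensional
  refine ((ContMDiffAt.comp y (hL.contMDiff _) hmid).cl_mul (contMDiffAt_const (c :=
    vec (m + 1) (x : EuclideanSpace ℝ (Fin (m + 1))).ofLp))).congr_of_eventuallyEq ?_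
  have hopen : IsOpen {y : Sph m | (y : EuclideanSpace ℝ (Fin (m + 1))) + x ≠ 0} :=
    isOpen_ne_fun (by fun_prop) continuous_const
  filter_upwards [hopen.mem_nhds h] with z hz
  exact coe_spinRotation hz

end Sections

/-! ### Local trivializations of `π` and equivariance of `Θ_m` -/

section Trivializations

open Set Topology

open Classical in
/-- The element `s` of `Spin_m` with `w ι(s) = w'`, if there is one. -/
noncomputable def spinDiff {m : ℕ} (w w' : Spin (m + 1)) : Spin m :=
  if h : ∃ s : Spin m, w * spinIncl m s = w' then h.choose else 1

theorem spinDiff_act {m : ℕ} (w : Spin (m + 1)) (s : Spin m) :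
    spinDiff w (w * spinIncl m s) = s := by
  have h : ∃ t : Spin m, w * spinIncl m t = w * spinIncl m s := ⟨s, rfl⟩
  rw [spinDiff, dif_pos h]
  exact spinIncl_injective m (mul_left_cancel h.choose_spec)

theorem mul_spinIncl_spinDiff {m : ℕ} (hm : m ≠ 0) {w w' : Spin (m + 1)}
    (h : spinProj m w = spinProj m w') : w * spinIncl m (spinDiff w w') = w' := by
  obtain ⟨s, rfl⟩ := exists_act_eq hm h
  rw [spinDiff_act]

/-- This expresses a choice by a linear retraction applied to `w⁻¹ w'`, from which smoothness of the
fibre coordinate follows. -/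
theorem coe_spinDiff {m : ℕ} (hm : m ≠ 0) {w w' : Spin (m + 1)}
    (h : spinProj m w = spinProj m w') :
    (spinDiff w w' : Cl m) = clRetract m (((w⁻¹ * w' : Spin (m + 1)) : Cl (m + 1))) := by
  rw [← eq_inv_mul_iff_mul_eq.mpr (mul_spinIncl_spinDiff hm h)]
  exact (clRetract_clIncl m _).symm

/-- `π` is trivial over the complement of `-x`. -/
theorem exists_smooth_trivialization {m : ℕ} (hm : m ≠ 0) (x : Sph m) :
    ∃ e : Bundle.Trivialization (Spin m) (spinProj m), x ∈ e.baseSet ∧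
      ContMDiffOn (𝓡 ((m + 1).choose 2)) ((𝓡 m).prod (𝓡 (m.choose 2))) ∞ e e.source ∧
      ContMDiffOn ((𝓡 m).prod (𝓡 (m.choose 2))) (𝓡 ((m + 1).choose 2)) ∞
        e.toOpenPartialHomeomorph.symm e.target ∧
      ∀ p ∈ e.source, ∀ g, e (p * spinIncl m g) = ((e p).1, (e p).2 * g) := by
  obtain ⟨w, hw⟩ := spinProj_surjective hm x
  let U : Set (Sph m) := {y | (y : EuclideanSpace ℝ (Fin (m + 1))) + x ≠ 0}
  have hU : IsOpen U := isOpen_ne_fun (by fun_prop) continuous_const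
  have hUs : IsOpen (spinProj m ⁻¹' U) := hU.preimage (contMDiff_spinProj m).continuous
  -- A section of `π` away from `-x`: a lift `w` of `x`, moved by the lifted rotation from `x` to
  -- `y`.
  let σ : Sph m → Spin (m + 1) := fun y => spinRotation x y * w
  have hσ : ∀ y ∈ U, spinProj m (σ y) = y := fun y hy => spinProj_spinRotation_mul hw hy
  have hσs : ∀ y ∈ U, ContMDiffAt (𝓡 m) (𝓡 ((m + 1).choose 2)) ∞ σ y := fun y hy =>
    (contMDiffAt_spinRotation hy).mul contMDiffAt_const
  have hto : ContMDiffOn (𝓡 ((m + 1).choose 2)) ((𝓡 m).prod (𝓡 (m.choose 2))) ∞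
      (fun p => (spinProj m p, spinDiff (σ (spinProj m p)) p)) (spinProj m ⁻¹' U) := by
    intro p hp
    refine ContMDiffAt.contMDiffWithinAt ?_
    refine (contMDiff_spinProj m p).prodMk ((Spin.isSubmanifoldStructure m).contMDiffAt ?_)
    have h1 : ContMDiffAt (𝓡 ((m + 1).choose 2)) (𝓡 ((m + 1).choose 2)) ∞
        (fun p => (σ (spinProj m p))⁻¹ * p) p :=
      ((hσs _ hp).comp p (contMDiff_spinProj m p)).inv.mul contMDiffAt_id
    have h2 := (clRetract m).contDiff_of_finiteDimensional (k := ∞)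
    refine (ContMDiffAt.comp p ((h2.contMDiff.comp (Spin.contMDiff_coe (m + 1))) _) h1
      ).congr_of_eventuallyEq ?_
    filter_upwards [hUs.mem_nhds hp] with q hq
    exact coe_spinDiff hm (hσ _ hq)
  have hinv : ContMDiffOn ((𝓡 m).prod (𝓡 (m.choose 2))) (𝓡 ((m + 1).choose 2)) ∞
      (fun z : Sph m × Spin m => σ z.1 * spinIncl m z.2) (U ×ˢ univ) := by
    intro z hz
    refine ContMDiffAt.contMDiffWithinAt ?_
    exact (contMDiff_spin_act m).contMDiffAt.comp z
      (((hσs _ hz.1).comp z contMDiffAt_fst).prodMk contMDiffAt_snd)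
  let e : Bundle.Trivialization (Spin m) (spinProj m) :=
    { toFun := fun p => (spinProj m p, spinDiff (σ (spinProj m p)) p)
      invFun := fun z => σ z.1 * spinIncl m z.2
      source := spinProj m ⁻¹' U
      target := U ×ˢ univ
      map_source' := fun p hp => ⟨hp, mem_univ _⟩
      map_target' := fun z hz => by
        rw [mem_preimage, spinProj_act, hσ _ hz.1]
        exact hz.1
      left_inv' := fun p hp => mul_spinIncl_spinDiff hm (hσ _ hp)
      right_inv' := fun z hz => by
        rw [spinProj_act, hσ _ hz.1, spinDiff_act]
      open_source := hUs
      open_target := hU.prod isOpen_univ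
      continuousOn_toFun := hto.continuousOn
      continuousOn_invFun := hinv.continuousOn
      baseSet := U
      open_baseSet := hU
      source_eq := rfl
      target_eq := rfl
      proj_toFun := fun _ _ => rfl }
  refine ⟨e, ?_, hto, hinv, fun p hp g => ?_⟩
  · change (x : EuclideanSpace ℝ (Fin (m + 1))) + x ≠ 0
    rw [← two_smul ℝ]
    exact smul_ne_zero two_ne_zero (ne_zero_of_mem_unit_sphere x)
  · change (spinProj m (p * spinIncl m g),
      spinDiff (σ (spinProj m (p * spinIncl m g))) (p * spinIncl m g)) =
      (spinProj m p, spinDiff (σ (spinProj m p)) p * g)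
    rw [spinProj_act]
    congr 1
    nth_rewrite 2 [← mul_spinIncl_spinDiff hm (hσ _ hp)]
    rw [mul_assoc, ← map_mul, spinDiff_act]

theorem isPrincipalBundle_spinProj {m : ℕ} (hm : m ≠ 0) :
    IsPrincipalBundle (m.choose 2) m ((m + 1).choose 2)
      (fun (w : Spin (m + 1)) (s : Spin m) => w * spinIncl m s) (spinProj m) where
  lieGroup := Spin.lieGroup m
  isManifold_base := IsManifold.of_le (n := ω) le_top
  isManifold_total := Spin.isManifold (m + 1)
  act_one p := by rw [map_one, mul_one]
  act_mul p g h := by rw [map_mul, mul_assoc]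
  contMDiff_act := contMDiff_spin_act m
  contMDiff_proj := contMDiff_spinProj m
  surjective_proj := spinProj_surjective hm
  fibre := spinProj_act
  simply_transitive p q h := by
    obtain ⟨s, hs⟩ := exists_act_eq hm h
    refine ⟨s, hs, fun t ht => ?_⟩
    exact spinIncl_injective m (mul_left_cancel (ht.trans hs.symm))
  locally_trivial := exists_smooth_trivialization hm

/-- Under `Ψ` the action of `SO_m` on frames is right multiplication by `diag(1, A)`, so this is
multiplicativity of `ϑ` together with `spinCover_spinIncl`. -/
theorem spinFrame_act {m : ℕ} (w : Spin (m + 1)) (s : Spin m) :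
    spinFrame m (w * spinIncl m s) = (spinFrame m w).act (spinCover m s) := by
  apply (frameOfSO m).symm.injective
  rw [spinFrame, Equiv.symm_apply_apply]
  apply Subtype.ext
  rw [map_mul, Submonoid.coe_mul, spinCover_spinIncl]
  change _ = frameMatrix (column (spinCover (m + 1) w).1 0) fun j =>
    ∑ i, (spinCover m s).1 i j • column (spinCover (m + 1) w).1 i.succ
  ext i j
  rw [Matrix.mul_apply, Fin.sum_univ_succ]
  refine Fin.cases ?_ (fun j => ?_) j
  · simp [frameMatrix, blockIncl, column]
  · simp [frameMatrix, blockIncl, column, mul_comm]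

theorem pt_spinFrame {m : ℕ} (w : Spin (m + 1)) : (spinFrame m w).pt = spinProj m w := by
  apply Subtype.ext
  change column _ 0 = WithLp.toLp 2 _
  rw [Matrix.mulVec_single_one]
  rfl

end Trivializations

/-- `Spin_m`, `Spin_{m+1}` and `SO(S^m)` carry their smooth structures as embedded submanifolds of
`Cl_m`, `Cl_{m+1}` and `ℝ^{m+1} × (ℝ^{m+1})^m`; the projection `π` of `Spin(S^m) = Spin_{m+1}` is
a principal `Spin_m`-bundle over the round sphere, and `Θ_m` is a spin structure. -/
theorem mainTheorem1 (m : ℕ) (hm : 2 ≤ m) :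
    ∃ (_ : ChartedSpace (EuclideanSpace ℝ (Fin (m.choose 2))) (Spin m))
      (_ : ChartedSpace (EuclideanSpace ℝ (Fin ((m + 1).choose 2))) (Spin (m + 1)))
      (_ : ChartedSpace (EuclideanSpace ℝ (Fin ((m + 1).choose 2))) (SphereFrame m)),
      IsSubmanifoldStructure (m.choose 2) (fun s : Spin m => (s : Cl m)) ∧
      IsSubmanifoldStructure ((m + 1).choose 2) (fun w : Spin (m + 1) => (w : Cl (m + 1))) ∧
      IsSubmanifoldStructure ((m + 1).choose 2) (SphereFrame.incl (m := m)) ∧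
      IsPrincipalBundle (m.choose 2) m ((m + 1).choose 2)
        (fun (w : Spin (m + 1)) (s : Spin m) => w * spinIncl m s) (spinProj m) ∧
      IsSpinStructure (m.choose 2) m ((m + 1).choose 2) m
        (SphereFrame.pt (m := m)) SphereFrame.act
        (fun (w : Spin (m + 1)) (s : Spin m) => w * spinIncl m s) (spinProj m)
        (spinFrame m) := by
  have hm0 : m ≠ 0 := by omega
  exact ⟨Spin.chartedSpace m, Spin.chartedSpace (m + 1), SphereFrame.chartedSpace m,
    Spin.isSubmanifoldStructure m, Spin.isSubmanifoldStructure (m + 1),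
    SphereFrame.isSubmanifoldStructure m, isPrincipalBundle_spinProj hm0,
    { principal := isPrincipalBundle_spinProj hm0
      isManifold_frame := SphereFrame.isManifold m
      covering := isCoveringMap_spinFrame m
      two_fold := ncard_spinFrame_fibre m
      local_diffeo := isLocalDiffeomorph_spinFrame m
      over_base := pt_spinFrame
      equivariant := spinFrame_act }⟩
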